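/- Let $M$ be a smooth connected Hausdorff Banach manifold modelled on a real Banach space $E$. A local vector field is a smooth section of $TM$ over an open set $\mathrm{Dom}(X)\subset M$; $\phi^X_t$ denotes its flow, defined on its maximal open domain. For a chart $\phi$, $\|J^m(X)(y)\|_\phi=\sum_{i=0}^m\|D^i(\phi_*X)(\phi(y))\|$. Let $\mathcal X$ be a set of local vector fields on $M$ whose domains cover $M$, and let $s\ge 0$ be an integer such that for every $x\in M$ there are a chart $\phi_x$ centered at $x$ and a constant $k_x$ with $\|J^{s+2}(X)(x)\|_{\phi_x}\le k_x$ for all $X\in\mathcal X$ with $x\in\mathrm{Dom}(X)$. Fix any such family $(\phi_x,k_x)_{x\in M}$. For a set $\mathcal S$ of local vector fields, let $\hat{\mathcal S}$ be the set of local vector fields $Y$ such that, on $\mathrm{Dom}(Y)$, $Y=(\phi^{X_p}_{t_p}\circ\cdots\circ\phi^{X_1}_{t_1})_*(\nu X)$ for some $X_1,\dots,X_p,X\in\mathcal S$, $t_i\in\mathbb R$, $\nu>0$, and such that $\|J^{s+2}(Y)(x)\|_{\phi_x}\le k_x$ for at least one $x\in\mathrm{Dom}(Y)$. Let $\xi=(X_n)_{n\in\mathbb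 N}$ be a sequence of local vector fields (a finite family is included by repeating a field with times $0$) and let $\tau=(\tau_n)$ be a real sequence with $\|\tau\|_1=\sum|\tau_n|<\infty$. Suppose that there are a chart $\psi$ centered at a point $x_0$, with domain $V\subset\bigcap_n\mathrm{Dom}(X_n)$, and $r,c>0$ such that $\|J^{s+2}(X_n)(y)\|_\psi\le c$ for all $n$ and $y\in V$, $\bar B(0,2r)\subset\psi(V)$ and $\|\tau\|_1\le r/c$. Then $\phi^\xi_\tau$ denotes any local $C^s$-diffeomorphism defined on a connected open neighborhood $U$ of $x_0$ with $U\subset\psi^{-1}(B(0,r))$, such that for all $x\in U$ all the finite compositions $\phi^{X_m}_{\tau_m}\circ\cdots\circ\phi^{X_0}_{\tau_0}(x)$ are defined and converge to $\phi^\xi_\tau(x)$ as $m\to\infty$. The pseudogroup $\mathcal G_{\mathcal S}$ consists of the finite compositions, and their restrictions to open sets, of local diffeomorphisms of the following types: (i) $\phi^X_t$ with $X\in\mathcal S$, $t\in\mathbb R$; (ii) $\phi^\xi_\tau$ or $[\phi^\xi_\tau]^{-1}$ as above, where $\xi$ is a family of elements of $\hat{\mathcal S}$. The $\mathcal S$-orbit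 of $x$ is $\{\Psi(x)\;:\;\Psi\in\mathcal G_{\mathcal S},\ x\in\mathrm{Dom}(\Psi)\}$. An $\mathcal S$-piecewise smooth curve is a continuous $\gamma:[a,b]\to M$ which, on each closed interval of some finite subdivision of $[a,b]$, is an integral curve of $X$ or $-X$ for some $X\in\mathcal S$. An $l^1$-integral curve of $\mathcal S$ is a continuous $\gamma:[a,b]\to M$ for which there are $a=t_0\le t_1\le\cdots$ with $t_n\to b$ such that on each nonempty $]t_n,t_{n+1}[$ it is an integral curve of $X$ or $-X$ for some $X\in\mathcal S$. An $l^1$-curve of $\mathcal S$ is a continuous curve that is a finite concatenation of $l^1$-integral curves of $\mathcal S$ and of reversed $l^1$-integral curves of $\mathcal S$. Then: 1. Each point of the $\mathcal X$-orbit of $x$ can be joined from $x$ by an $l^1$-curve of $\hat{\mathcal X}$, that is, one whose smooth parts are tangent to $Y$ or $-Y$ with $Y\in\hat{\mathcal X}$. 2. For each pair $(x,y)$ in the same $\mathcal X$-orbit, either there is an $\mathcal X$-piecewise smooth curve which joins $x$ to $y$, or there is a sequence of $\mathcal X$-piecewise smooth curves, all with origin $x$, whose ends converge to $y$. 3. $\mathcal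 G_{\hat{\mathcal X}}=\mathcal G_{\mathcal X}$, where $\mathcal G_{\hat{\mathcal X}}$ is formed with the same $(\phi_x,k_x)_{x\in M}$. In particular the $\hat{\mathcal X}$-orbit of each point is its $\mathcal X$-orbit. -/

import Mathlib

open Set Filter Topology
open scoped Manifold ContDiff

noncomputable section

namespace L1Orbit

/-- A local vector field on `M`: a smooth section of `TM` over an open set `dom`.
Values of `toFun` outside `dom` are never used. -/
structure LocalVectorField (E M : Type*) [NormedAddCommGroup E] [NormedSpace ℝ E]
    [TopologicalSpace M] [ChartedSpace E M] [IsManifold 𝓘(ℝ, E) ∞ M] where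
  dom : Set M
  isOpen_dom : IsOpen dom
  toFun : (x : M) → TangentSpace 𝓘(ℝ, E) x
  smooth : ContMDiffOn 𝓘(ℝ, E) (𝓘(ℝ, E)).tangent ∞
    (fun x => (⟨x, toFun x⟩ : TangentBundle 𝓘(ℝ, E) M)) dom

section

variable {E M : Type*} [NormedAddCommGroup E] [NormedSpace ℝ E]
  [TopologicalSpace M] [ChartedSpace E M] [IsManifold 𝓘(ℝ, E) ∞ M]

/-! ### Curves -/

/-- On the set `J` of times, `γ` stays in the domain of `X` and is an integral curve of `X`. -/
def IsIntegralCurve (X : LocalVectorField E M) (γ : ℝ → M) (J : Set ℝ) : Prop :=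
  (∀ t ∈ J, γ t ∈ X.dom) ∧ IsMIntegralCurveOn γ X.toFun J

/-- On the set `J` of times, `γ` stays in the domain of `X` and is an integral curve of `-X`. -/
def IsNegIntegralCurve (X : LocalVectorField E M) (γ : ℝ → M) (J : Set ℝ) : Prop :=
  (∀ t ∈ J, γ t ∈ X.dom) ∧ IsMIntegralCurveOn γ (fun x => -(X.toFun x)) J

/-- On `J`, the curve `γ` is an integral curve of `X` or of `-X` for some `X ∈ ξ`. -/
def IsTangentPiece (ξ : Set (LocalVectorField E M)) (γ : ℝ → M) (J : Set ℝ) : Prop :=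
  ∃ X ∈ ξ, IsIntegralCurve X γ J ∨ IsNegIntegralCurve X γ J

/-- `γ : [a, b] → M` is a `ξ`-piecewise smooth curve: for some finite subdivision of `[a, b]`, on
each closed subinterval it is an integral curve of `X` or `-X` for some `X ∈ ξ`. -/
def IsPiecewiseSmoothCurve (ξ : Set (LocalVectorField E M)) (γ : ℝ → M) (a b : ℝ) : Prop :=
  ContinuousOn γ (Icc a b) ∧
  ∃ (n : ℕ) (t : ℕ → ℝ), Monotone t ∧ t 0 = a ∧ t n = b ∧
    ∀ i < n, IsTangentPiece ξ γ (Icc (t i) (t (i + 1)))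

/-- `γ : [a, b] → M` is an `l¹`-integral curve of `ξ`: it is continuous, and there are
`a = t 0 ≤ t 1 ≤ t 2 ≤ ⋯` tending to `b` such that on each nonempty open interval
`]t i, t (i + 1)[` it is an integral curve of `X` or `-X` for some `X ∈ ξ`.
(Finite subdivisions are the sequences that are eventually equal to `b`.) -/
def IsL1IntegralCurve (ξ : Set (LocalVectorField E M)) (γ : ℝ → M) (a b : ℝ) : Prop :=
  ContinuousOn γ (Icc a b) ∧
  ∃ t : ℕ → ℝ, Monotone t ∧ t 0 = a ∧ Tendsto t atTop (𝓝 b) ∧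
    ∀ i, t i < t (i + 1) → IsTangentPiece ξ γ (Ioo (t i) (t (i + 1)))

/-- `γ : [a, b] → M` is an `l¹`-curve of `ξ`: it is a finite concatenation of
`l¹`-integral curves of `ξ` and of curves which, run backwards, are `l¹`-integral curves of `ξ`. -/
def IsL1Curve (ξ : Set (LocalVectorField E M)) (γ : ℝ → M) (a b : ℝ) : Prop :=
  ContinuousOn γ (Icc a b) ∧
  ∃ (n : ℕ) (u : ℕ → ℝ), Monotone u ∧ u 0 = a ∧ u n = b ∧
    ∀ i < n, IsL1IntegralCurve ξ γ (u i) (u (i + 1)) ∨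
      IsL1IntegralCurve ξ (fun s => γ (u i + u (i + 1) - s)) (u i) (u (i + 1))

/-! ### Flows and local diffeomorphisms -/

/-- `y = φ^X_t(x)`: there is an integral curve of `X` over the time interval between `0` and `t`
that is at `x` at time `0` and at `y` at time `t`. -/
def FlowRel (X : LocalVectorField E M) (t : ℝ) (x y : M) : Prop :=
  ∃ γ : ℝ → M, γ 0 = x ∧ γ t = y ∧ IsIntegralCurve X γ (uIcc 0 t)

/-- `e` is a local diffeomorphism of class `C^n`. -/
def IsLocalDiffeo (E : Type*) {M : Type*} [NormedAddCommGroup E] [NormedSpace ℝ E]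
    [TopologicalSpace M] [ChartedSpace E M] (n : ℕ∞ω) (e : OpenPartialHomeomorph M M) : Prop :=
  ContMDiffOn 𝓘(ℝ, E) 𝓘(ℝ, E) n e e.source ∧ ContMDiffOn 𝓘(ℝ, E) 𝓘(ℝ, E) n e.symm e.target

/-- `e` is the flow `φ^X_t`, on its maximal domain or on an open subset of it. -/
def IsFlowMap (X : LocalVectorField E M) (t : ℝ) (e : OpenPartialHomeomorph M M) : Prop :=
  IsLocalDiffeo E ∞ e ∧ ∀ x ∈ e.source, FlowRel X t x (e x)

/-- The composition `eₙ ∘ ⋯ ∘ e₁` of the list `[e₁, …, eₙ]`, on its natural domain. -/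
def comp : List (OpenPartialHomeomorph M M) → OpenPartialHomeomorph M M
  | [] => OpenPartialHomeomorph.refl M
  | e :: l => e.trans (comp l)

/-! ### Jets in charts -/

/-- `φ` is a chart of the smooth structure of `M` centered at `x`. -/
def IsChartCenteredAt (φ : OpenPartialHomeomorph M E) (x : M) : Prop :=
  φ ∈ IsManifold.maximalAtlas 𝓘(ℝ, E) ∞ M ∧ x ∈ φ.source ∧ φ x = 0

/-- The vector field `φ_* X`, read in `E`. -/
def localRep (φ : OpenPartialHomeomorph M E) (X : LocalVectorField E M) : E → E :=
  fun z => mfderiv 𝓘(ℝ, E) 𝓘(ℝ, E) φ (φ.symm z) (X.toFun (φ.symm z))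

/-- The norm `‖J^m(X)(y)‖_φ` of the `m`-jet of `X` at `y` in the chart `φ`: the sum of the norms of
the derivatives of orders `0, …, m` of `φ_* X` at `φ y`. -/
def jetNorm (φ : OpenPartialHomeomorph M E) (m : ℕ) (X : LocalVectorField E M) (y : M) : ℝ :=
  ∑ i ∈ Finset.range (m + 1), ‖iteratedFDeriv ℝ i (localRep φ X) (φ y)‖

/-! ### The enlarged family, the pseudogroup and the orbits -/

/-- `Y = Φ_* (ν X)` on the domain of `Y`: each `(y, Y y)` is the image under `TΦ` of some
`(p, ν X p)` with `p` in the domains of `Φ` and `X`. -/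
def IsPushforward (Φ : OpenPartialHomeomorph M M) (ν : ℝ) (X Y : LocalVectorField E M) : Prop :=
  ∀ y ∈ Y.dom, ∃ p ∈ Φ.source ∩ X.dom,
    (⟨y, Y.toFun y⟩ : TangentBundle 𝓘(ℝ, E) M) =
      ⟨Φ p, mfderiv 𝓘(ℝ, E) 𝓘(ℝ, E) Φ p (ν • X.toFun p)⟩

/-- The enlargement of a family `S`, relative to a choice, for each point `x`, of a chart `φ x`
and a constant `k x`: all local vector fields `Y = Φ_* (ν X)` with `X ∈ S`, `ν > 0` and `Φ` a
finite composition of flows of elements of `S`, such that at some point `x` of the domain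
of `Y` the `m`-jet of `Y` has norm at most `k x`. -/
def hat (φ : M → OpenPartialHomeomorph M E) (k : M → ℝ) (m : ℕ)
    (S : Set (LocalVectorField E M)) : Set (LocalVectorField E M) :=
  {Y | (∃ (l : List (OpenPartialHomeomorph M M)) (ν : ℝ), ∃ X ∈ S,
          (∀ e ∈ l, ∃ Z ∈ S, ∃ t : ℝ, IsFlowMap Z t e) ∧ 0 < ν ∧ IsPushforward (comp l) ν X Y) ∧
        ∃ x ∈ Y.dom, jetNorm (φ x) m Y x ≤ k x}

/-- `e` is the local `C^s`-diffeomorphism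
`φ^ξ_τ = lim_{m → ∞} φ^{X_m}_{τ_m} ∘ ⋯ ∘ φ^{X_0}_{τ_0}` on a connected open neighborhood of a
point `x₀`. Here `ψ` is a chart centered at `x₀` whose domain is contained in that of each `X_n`
and on which the `(s+2)`-jets of all `X_n` are bounded by one constant `c > 0`; the image of `ψ`
contains the closed ball of radius `2 r`, and `‖τ‖₁ ≤ r / c`. Finite families are included by
repeating a field with times `0`. -/
def IsL1FlowMap (s : ℕ) (ξ : ℕ → LocalVectorField E M) (τ : ℕ → ℝ)
    (e : OpenPartialHomeomorph M M) : Prop :=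
  ∃ (x₀ : M) (ψ : OpenPartialHomeomorph M E) (r c : ℝ),
    IsChartCenteredAt ψ x₀ ∧ 0 < r ∧ 0 < c ∧ Metric.closedBall 0 (2 * r) ⊆ ψ.target ∧
    (∀ n, ψ.source ⊆ (ξ n).dom) ∧
    (∀ n, ∀ y ∈ ψ.source, jetNorm ψ (s + 2) (ξ n) y ≤ c) ∧
    Summable (fun n => |τ n|) ∧ ∑' n, |τ n| ≤ r / c ∧
    x₀ ∈ e.source ∧ IsConnected e.source ∧ e.source ⊆ ψ.source ∩ ψ ⁻¹' Metric.ball 0 r ∧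
    IsLocalDiffeo E s e ∧
    ∀ x ∈ e.source, ∃ p : ℕ → M, p 0 = x ∧ (∀ n, FlowRel (ξ n) (τ n) (p n) (p (n + 1))) ∧
      Tendsto p atTop (𝓝 (e x))

/-- The generators of the pseudogroup of `S`: the flows `φ^X_t` with `X ∈ S`, and the maps
`φ^ξ_τ` and `(φ^ξ_τ)⁻¹` for the countable families `ξ` in the enlargement of `S`. -/
def IsGenerator (φ : M → OpenPartialHomeomorph M E) (k : M → ℝ) (s : ℕ)
    (S : Set (LocalVectorField E M)) (e : OpenPartialHomeomorph M M) : Prop :=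
  (∃ X ∈ S, ∃ t : ℝ, IsFlowMap X t e) ∨
  ∃ (ξ : ℕ → LocalVectorField E M) (τ : ℕ → ℝ), (∀ n, ξ n ∈ hat φ k (s + 2) S) ∧
    (IsL1FlowMap s ξ τ e ∨ IsL1FlowMap s ξ τ e.symm)

/-- The pseudogroup of `S`: all finite compositions (of at least one factor) of generators, and
their restrictions to open sets. -/
def pseudogroup (φ : M → OpenPartialHomeomorph M E) (k : M → ℝ) (s : ℕ)
    (S : Set (LocalVectorField E M)) : Set (OpenPartialHomeomorph M M) :=
  {Ψ | ∃ l : List (OpenPartialHomeomorph M M), l ≠ [] ∧ (∀ e ∈ l, IsGenerator φ k s S e) ∧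
        Ψ.source ⊆ (comp l).source ∧ EqOn Ψ (comp l) Ψ.source}

/-- The `S`-orbit (`l¹`-orbit of `S`) of `x`. -/
def orbit (φ : M → OpenPartialHomeomorph M E) (k : M → ℝ) (s : ℕ)
    (S : Set (LocalVectorField E M)) (x : M) : Set M :=
  {y | ∃ Ψ ∈ pseudogroup φ k s S, x ∈ Ψ.source ∧ Ψ x = y}

end

end L1Orbit

end

/-! Everything reduces to `FlowStep S`, "lying on a common trajectory of a field of `S`", and its
reflexive transitive closure, reachability.

Pseudogroups: if `Y = Φ_*(νX)`, then `Φ⁻¹` carries a trajectory of `Y` for time `t` to one of `X`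
for time `νt`. So a flow map of `Y` is a restriction of `Φ ∘ φ^X_{νt} ∘ Φ⁻¹`, a composition of flow
maps of `S` (`IsFlowMap.exists_restricts`). It follows that enlarging twice gives nothing new
(`hat_hat`) and that the two pseudogroups agree (`pseudogroup_hat`).

Curves: the trajectories that make up `φ^ξ_τ` from `x` take total time `‖τ‖₁`. In the chart their
speed is at most `c`, so they stay in the chart and shrink to the limit point; glued together they
form an `l¹`-integral curve (`IsL1Trajectory.l1Step`). An inverse `(φ^ξ_τ)⁻¹` gives such a curve in
the opposite direction.

Approximation: a generator sends `x` into the closure of the set reachable from `x`. For `φ^ξ_τ` the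
finite compositions converge. For the inverse, start at the end `y = lim p n` and run the fields
`n-1, …, 0` backwards: by Grönwall the error at the origin is at most `exp(c‖τ‖₁)` times the
distance from `y` to `p n` in the chart, which tends to `0` (`IsL1Trajectory.mem_closure_reach`).
Continuity of the generators extends this to compositions (`comp_mem_closure`). -/

namespace L1Orbit

section

variable {M : Type*} [TopologicalSpace M]

/-! ### Partial homeomorphisms, restrictions and compositions -/

/-- `e` is a restriction of `f`. -/
def Restricts (e f : OpenPartialHomeomorph M M) : Prop :=
  e.source ⊆ f.source ∧ EqOn e f e.source

lemma Restricts.refl (e : OpenPartialHomeomorph M M) : Restricts e e :=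
  ⟨Subset.rfl, fun _ _ => rfl⟩

lemma Restricts.trans {e f g : OpenPartialHomeomorph M M} (h : Restricts e f)
    (h' : Restricts f g) : Restricts e g :=
  ⟨h.1.trans h'.1, fun _ hx => (h.2 hx).trans (h'.2 (h.1 hx))⟩

lemma Restricts.comp {e f e' f' : OpenPartialHomeomorph M M} (h : Restricts e f)
    (h' : Restricts e' f') : Restricts (e.trans e') (f.trans f') := by
  constructor
  · intro x hx
    rw [OpenPartialHomeomorph.trans_source] at hx ⊢
    exact ⟨h.1 hx.1, by simpa [h.2 hx.1] using h'.1 hx.2⟩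
  · intro x hx
    rw [OpenPartialHomeomorph.trans_source] at hx
    simp only [OpenPartialHomeomorph.coe_trans, Function.comp_apply]
    rw [h'.2 hx.2, h.2 hx.1]

lemma comp_append (l l' : List (OpenPartialHomeomorph M M)) :
    comp (l ++ l') = (comp l).trans (comp l') := by
  induction l with
  | nil => simp [comp]
  | cons e l ih => simp [comp, ih, OpenPartialHomeomorph.trans_assoc]

lemma comp_reverse_symm (l : List (OpenPartialHomeomorph M M)) :
    comp (l.map OpenPartialHomeomorph.symm).reverse = (comp l).symm := by
  induction l with
  | nil => simp [comp]
  | cons e l ih =>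
    simp [comp, comp_append, ih, OpenPartialHomeomorph.trans_symm_eq_symm_trans_symm]

/-- Replacing each factor of a composition by a composition that extends it. -/
lemma exists_restricts_comp {P Q : OpenPartialHomeomorph M M → Prop}
    (h : ∀ e, P e → ∃ l, l ≠ [] ∧ (∀ f ∈ l, Q f) ∧ Restricts e (comp l))
    (l : List (OpenPartialHomeomorph M M)) (hl : ∀ e ∈ l, P e) :
    ∃ l', (l ≠ [] → l' ≠ []) ∧ (∀ f ∈ l', Q f) ∧ Restricts (comp l) (comp l') := by
  induction l with
  | nil => exact ⟨[], by simp, by simp, Restricts.refl _⟩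
  | cons e l ih =>
    obtain ⟨l₁, hne, h₁, r₁⟩ := h e (hl e (by simp))
    obtain ⟨l₂, -, h₂, r₂⟩ := ih fun f hf => hl f (by simp [hf])
    refine ⟨l₁ ++ l₂, fun _ => by simp [hne], fun f hf => ?_, ?_⟩
    · rcases List.mem_append.1 hf with hf | hf
      exacts [h₁ f hf, h₂ f hf]
    · rw [comp_append]
      exact r₁.comp r₂

end

section

variable {E M : Type*} [NormedAddCommGroup E] [NormedSpace ℝ E]
  [TopologicalSpace M] [ChartedSpace E M]

lemma IsLocalDiffeo.refl (n : ℕ∞ω) : IsLocalDiffeo E n (OpenPartialHomeomorph.refl M) :=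
  ⟨contMDiffOn_id, contMDiffOn_id⟩

lemma IsLocalDiffeo.symm {n : ℕ∞ω} {e : OpenPartialHomeomorph M M} (h : IsLocalDiffeo E n e) :
    IsLocalDiffeo E n e.symm :=
  ⟨h.2, h.1⟩

lemma IsLocalDiffeo.trans {n : ℕ∞ω} {e f : OpenPartialHomeomorph M M}
    (he : IsLocalDiffeo E n e) (hf : IsLocalDiffeo E n f) : IsLocalDiffeo E n (e.trans f) := by
  constructor
  · rw [OpenPartialHomeomorph.trans_source]
    exact hf.1.comp (he.1.mono inter_subset_left) fun x hx => hx.2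
  · rw [OpenPartialHomeomorph.trans_target]
    exact he.2.comp (hf.2.mono inter_subset_left) fun x hx => hx.2

lemma IsLocalDiffeo.comp {n : ℕ∞ω} {l : List (OpenPartialHomeomorph M M)}
    (h : ∀ e ∈ l, IsLocalDiffeo E n e) : IsLocalDiffeo E n (comp l) := by
  induction l with
  | nil => exact IsLocalDiffeo.refl n
  | cons e l ih => exact (h e (by simp)).trans (ih fun f hf => h f (by simp [hf]))

lemma IsLocalDiffeo.mdifferentiable {e : OpenPartialHomeomorph M M} (h : IsLocalDiffeo E ∞ e) :
    e.MDifferentiable 𝓘(ℝ, E) 𝓘(ℝ, E) :=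
  ⟨h.1.mdifferentiableOn (by simp), h.2.mdifferentiableOn (by simp)⟩

lemma mdifferentiable_of_mem_maximalAtlas [IsManifold 𝓘(ℝ, E) ∞ M]
    {ψ : OpenPartialHomeomorph M E} (h : ψ ∈ IsManifold.maximalAtlas 𝓘(ℝ, E) ∞ M) :
    ψ.MDifferentiable 𝓘(ℝ, E) 𝓘(ℝ, E) :=
  ⟨(contMDiffOn_of_mem_maximalAtlas h).mdifferentiableOn (by simp),
    (contMDiffOn_symm_of_mem_maximalAtlas h).mdifferentiableOn (by simp)⟩

/-! ### Pushforwards -/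

variable [IsManifold 𝓘(ℝ, E) ∞ M]

/-- `IsPushforward` only provides some preimage `p`; injectivity of `Φ` forces `p = Φ.symm y`. This
inverse form is the one that transports trajectories. -/
lemma IsPushforward.pullback {Φ : OpenPartialHomeomorph M M} {ν : ℝ} {X Y : LocalVectorField E M}
    (h : IsPushforward Φ ν X Y) (hΦ : Φ.MDifferentiable 𝓘(ℝ, E) 𝓘(ℝ, E)) {y : M}
    (hy : y ∈ Y.dom) :
    y ∈ Φ.target ∧ Φ.symm y ∈ X.dom ∧
      mfderiv 𝓘(ℝ, E) 𝓘(ℝ, E) Φ.symm y (Y.toFun y) = ν • X.toFun (Φ.symm y) := by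
  obtain ⟨p, ⟨hp, hpX⟩, hpy⟩ := h y hy
  injection hpy with h1 h2
  subst h1
  have hq : Φ.symm (Φ p) = p := Φ.left_inv hp
  refine ⟨Φ.map_source hp, by rwa [hq], ?_⟩
  rw [h2, hq]
  have := hΦ.symm_comp_deriv hp
  exact congrArg (fun L : TangentSpace 𝓘(ℝ, E) p →L[ℝ] TangentSpace 𝓘(ℝ, E) p =>
    L (ν • X.toFun p)) this

lemma IsPushforward.mono {Φ Φ' : OpenPartialHomeomorph M M} {ν : ℝ} {X Y : LocalVectorField E M}
    (h : IsPushforward Φ ν X Y) (hΦ : Restricts Φ Φ') : IsPushforward Φ' ν X Y := by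
  intro y hy
  obtain ⟨p, ⟨hp, hpX⟩, hpy⟩ := h y hy
  refine ⟨p, ⟨hΦ.1 hp, hpX⟩, hpy.trans ?_⟩
  have he : (Φ : M → M) =ᶠ[𝓝 p] Φ' :=
    Filter.eventuallyEq_of_mem (Φ.open_source.mem_nhds hp) hΦ.2
  exact Bundle.TotalSpace.ext (hΦ.2 hp) (by rw [he.mfderiv_eq]; exact HEq.rfl)

lemma IsPushforward.trans {Φ Ψ : OpenPartialHomeomorph M M} {ν μ : ℝ}
    {W X Y : LocalVectorField E M} (hY : IsPushforward Φ ν X Y) (hX : IsPushforward Ψ μ W X)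
    (hΦ : Φ.MDifferentiable 𝓘(ℝ, E) 𝓘(ℝ, E)) (hΨ : Ψ.MDifferentiable 𝓘(ℝ, E) 𝓘(ℝ, E)) :
    IsPushforward (Ψ.trans Φ) (ν * μ) W Y := by
  intro y hy
  obtain ⟨p, ⟨hp, hpX⟩, hpy⟩ := hY y hy
  obtain ⟨q, ⟨hq, hqW⟩, hqp⟩ := hX p hpX
  injection hqp with h1 h2
  subst h1
  refine ⟨q, ⟨by simp [hq, hp], hqW⟩, hpy.trans ?_⟩
  have hc := mfderiv_comp q (hΦ.mdifferentiableAt hp) (hΨ.mdifferentiableAt hq)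
  rw [h2]
  refine Bundle.TotalSpace.ext rfl (heq_of_eq ?_)
  change _ = (mfderiv 𝓘(ℝ, E) 𝓘(ℝ, E) (Φ ∘ Ψ) q) ((ν * μ) • W.toFun q)
  rw [hc, mul_smul]
  change mfderiv 𝓘(ℝ, E) 𝓘(ℝ, E) Φ (Ψ q) (ν • mfderiv 𝓘(ℝ, E) 𝓘(ℝ, E) Ψ q (μ • W.toFun q)) =
    mfderiv 𝓘(ℝ, E) 𝓘(ℝ, E) Φ (Ψ q) (mfderiv 𝓘(ℝ, E) 𝓘(ℝ, E) Ψ q (ν • μ • W.toFun q))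
  exact congrArg _ ((mfderiv 𝓘(ℝ, E) 𝓘(ℝ, E) Ψ q).map_smul ν (μ • W.toFun q)).symm

lemma IsPushforward.refl (X : LocalVectorField E M) :
    IsPushforward (OpenPartialHomeomorph.refl M) 1 X X := by
  intro y hy
  refine ⟨y, ⟨trivial, hy⟩, ?_⟩
  have : mfderiv 𝓘(ℝ, E) 𝓘(ℝ, E) (OpenPartialHomeomorph.refl M) y =
      ContinuousLinearMap.id ℝ (TangentSpace 𝓘(ℝ, E) y) := mfderiv_id
  rw [this]
  refine Bundle.TotalSpace.ext rfl (heq_of_eq ?_)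
  change X.toFun y = (1 : ℝ) • X.toFun y
  rw [one_smul]

/-! ### Flows -/

lemma FlowRel.mem_dom {X : LocalVectorField E M} {t : ℝ} {x y : M} (h : FlowRel X t x y) :
    x ∈ X.dom ∧ y ∈ X.dom := by
  obtain ⟨γ, rfl, rfl, hγ⟩ := h
  exact ⟨hγ.1 _ left_mem_uIcc, hγ.1 _ right_mem_uIcc⟩

lemma FlowRel.symm {X : LocalVectorField E M} {t : ℝ} {x y : M} (h : FlowRel X t x y) :
    FlowRel X (-t) y x := by
  obtain ⟨γ, rfl, rfl, hγ⟩ := h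
  have hs : uIcc 0 (-t) ⊆ {u | u + t ∈ uIcc 0 t} := by
    intro u hu
    simp only [mem_ofPred_eq, mem_uIcc] at hu ⊢
    rcases hu with hu | hu
    · right; constructor <;> linarith
    · left; constructor <;> linarith
  exact ⟨γ ∘ (· + t), by simp, by simp, fun u hu => hγ.1 _ (hs hu), (hγ.2.comp_add t).mono hs⟩

lemma IsFlowMap.symm {X : LocalVectorField E M} {t : ℝ} {e : OpenPartialHomeomorph M M}
    (h : IsFlowMap X t e) : IsFlowMap X (-t) e.symm := by
  refine ⟨h.1.symm, fun x hx => ?_⟩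
  simpa [e.right_inv hx] using (h.2 (e.symm x) (e.map_target hx)).symm

lemma mem_uIcc_zero_mul_inv {ν t u : ℝ} (hν : 0 < ν) (hu : u ∈ uIcc 0 (ν * t)) :
    u * ν⁻¹ ∈ uIcc 0 t := by
  have h : ν * (u * ν⁻¹) = u := by field_simp
  rw [mem_uIcc] at hu ⊢
  rw [← h] at hu
  rcases hu with hu | hu
  · exact Or.inl ⟨by simpa [hν] using hu.1, le_of_mul_le_mul_left hu.2 hν⟩
  · exact Or.inr ⟨le_of_mul_le_mul_left hu.1 hν, by nlinarith [hu.2]⟩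

/-- A diffeomorphism conjugates the flows of a field and of its pushforward. -/
lemma FlowRel.pullback {Φ : OpenPartialHomeomorph M M} {ν : ℝ} {X Y : LocalVectorField E M}
    (h : IsPushforward Φ ν X Y) (hν : 0 < ν) (hΦ : Φ.MDifferentiable 𝓘(ℝ, E) 𝓘(ℝ, E))
    {t : ℝ} {x y : M} (hxy : FlowRel Y t x y) :
    FlowRel X (ν * t) (Φ.symm x) (Φ.symm y) := by
  obtain ⟨γ, rfl, rfl, hγ⟩ := hxy
  have hs : uIcc 0 (ν * t) ⊆ {u | u * ν⁻¹ ∈ uIcc 0 t} := fun u hu => mem_uIcc_zero_mul_inv hν hu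
  refine ⟨Φ.symm ∘ γ ∘ (· * ν⁻¹), by simp, ?_, ?_, ?_⟩
  · have : ν * t * ν⁻¹ = t := by field_simp
    simp [this]
  · intro u hu
    exact (h.pullback hΦ (hγ.1 _ (hs hu))).2.1
  · intro u hu
    obtain ⟨h1, h2, h3⟩ := h.pullback hΦ (hγ.1 _ (hs hu))
    have hd := ((hγ.2.comp_mul ν⁻¹).mono hs) u hu
    have hc := (hΦ.symm.mdifferentiableAt h1).hasMFDerivAt.comp_hasMFDerivWithinAt u hd
    refine HasMFDerivWithinAt.congr_mfderiv hc ?_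
    ext
    -- Slowing time by `ν⁻¹` cancels the factor `ν` in `TΦ⁻¹ Y = ν X`.
    change mfderiv 𝓘(ℝ, E) 𝓘(ℝ, E) Φ.symm (γ (u * ν⁻¹)) ((1 : ℝ) • ν⁻¹ • Y.toFun (γ (u * ν⁻¹))) =
      (1 : ℝ) • X.toFun (Φ.symm (γ (u * ν⁻¹)))
    rw [map_smul, map_smul, h3, smul_smul ν⁻¹, inv_mul_cancel₀ hν.ne', one_smul]

end

section

variable {E M : Type*} [NormedAddCommGroup E] [NormedSpace ℝ E]
  [TopologicalSpace M] [ChartedSpace E M] [IsManifold 𝓘(ℝ, E) ∞ M]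

/-! ### The enlargement of a family and the pseudogroup -/

/-- `e` is a flow map of some element of `S`. -/
def IsFlowMapOf (S : Set (LocalVectorField E M)) (e : OpenPartialHomeomorph M M) : Prop :=
  ∃ Z ∈ S, ∃ t : ℝ, IsFlowMap Z t e

lemma IsFlowMapOf.isLocalDiffeo {S : Set (LocalVectorField E M)} {e : OpenPartialHomeomorph M M}
    (h : IsFlowMapOf S e) : IsLocalDiffeo E ∞ e :=
  let ⟨_, _, _, h⟩ := h
  h.1

lemma IsFlowMapOf.symm {S : Set (LocalVectorField E M)} {e : OpenPartialHomeomorph M M}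
    (h : IsFlowMapOf S e) : IsFlowMapOf S e.symm :=
  let ⟨Z, hZ, t, h⟩ := h
  ⟨Z, hZ, -t, h.symm⟩

lemma IsFlowMapOf.reverse {S : Set (LocalVectorField E M)}
    {l : List (OpenPartialHomeomorph M M)} (hl : ∀ e ∈ l, IsFlowMapOf S e) :
    ∀ e ∈ (l.map OpenPartialHomeomorph.symm).reverse, IsFlowMapOf S e := by
  intro e he
  obtain ⟨f, hf, rfl⟩ := List.mem_map.1 (List.mem_reverse.1 he)
  exact (hl f hf).symm

/-- A flow map of a pushforward `Φ_* (ν W)`, where `Φ` is a composition of flow maps of `S` and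
`W ∈ S`, is a restriction of a composition of flow maps of `S`. -/
lemma IsFlowMap.exists_restricts {S : Set (LocalVectorField E M)} {W Z : LocalVectorField E M}
    {l : List (OpenPartialHomeomorph M M)} {ν t : ℝ} {e : OpenPartialHomeomorph M M}
    (hl : ∀ f ∈ l, IsFlowMapOf S f) (hν : 0 < ν) (hW : W ∈ S)
    (h : IsPushforward (comp l) ν W Z) (he : IsFlowMap Z t e) :
    ∃ l', l' ≠ [] ∧ (∀ f ∈ l', IsFlowMapOf S f) ∧ Restricts e (comp l') := by
  have hd : IsLocalDiffeo E ∞ (comp l) := IsLocalDiffeo.comp fun f hf => (hl f hf).isLocalDiffeo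
  have hm := hd.mdifferentiable
  set Φ := comp l with hΦ
  -- The composition is `Φ⁻¹`, then `Φ⁻¹ ∘ e ∘ Φ`, which is a flow map of `W` for time `ν * t`, then
  -- `Φ`.
  refine ⟨(l.map OpenPartialHomeomorph.symm).reverse ++ ((Φ.trans e).trans Φ.symm) :: l,
    by simp, fun f hf => ?_, ?_⟩
  · rcases List.mem_append.1 hf with hf | hf
    · exact IsFlowMapOf.reverse hl f hf
    · rcases List.mem_cons.1 hf with rfl | hf
      · refine ⟨W, hW, ν * t, (hd.trans he.1).trans hd.symm, fun x hx => ?_⟩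
        simp only [OpenPartialHomeomorph.trans_source, mem_inter_iff, mem_preimage] at hx
        have := (he.2 (Φ x) hx.1.2).pullback h hν hm
        rwa [Φ.left_inv hx.1.1] at this
      · exact hl f hf
  · have hc : comp ((l.map OpenPartialHomeomorph.symm).reverse ++
        ((Φ.trans e).trans Φ.symm) :: l) = Φ.symm.trans (((Φ.trans e).trans Φ.symm).trans Φ) := by
      rw [comp_append, comp_reverse_symm]
      rfl
    rw [hc]
    -- Both ends of a trajectory of `Z` lie in `Z.dom`, which is contained in `Φ.target`, so the
    -- conjugation loses no point of `e.source`.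
    have key : ∀ x ∈ e.source, x ∈ Φ.target ∧ e x ∈ Φ.target := fun x hx =>
      ⟨(h.pullback hm (he.2 x hx).mem_dom.1).1, (h.pullback hm (he.2 x hx).mem_dom.2).1⟩
    constructor
    · intro x hx
      simp [Φ.right_inv (key x hx).1, key x hx, hx]
    · intro x hx
      simp [Φ.right_inv (key x hx).1, Φ.right_inv (key x hx).2]

variable {φ : M → OpenPartialHomeomorph M E} {k : M → ℝ} {m s : ℕ}
  {S : Set (LocalVectorField E M)}

lemma exists_restricts_of_isFlowMapOf_hat {e : OpenPartialHomeomorph M M}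
    (he : IsFlowMapOf (hat φ k m S) e) :
    ∃ l', l' ≠ [] ∧ (∀ f ∈ l', IsFlowMapOf S f) ∧ Restricts e (comp l') := by
  obtain ⟨Z, ⟨⟨l, ν, W, hW, hl, hν, h⟩, -⟩, t, he⟩ := he
  exact he.exists_restricts hl hν hW h

lemma subset_hat_hat : hat φ k m S ⊆ hat φ k m (hat φ k m S) := fun Y hY =>
  ⟨⟨[], 1, Y, hY, by simp, one_pos, IsPushforward.refl Y⟩, hY.2⟩

/-- Flow maps of fields in the enlargement restrict compositions of flow maps of `S`, so a
pushforward of a pushforward is a single one. The jet condition concerns only `Y` and the fixed `φ`,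
`k`, and is carried over unchanged. -/
lemma hat_hat : hat φ k m (hat φ k m S) = hat φ k m S := by
  refine Subset.antisymm (fun Y hY => ⟨?_, hY.2⟩) subset_hat_hat
  obtain ⟨⟨l, ν, X, ⟨⟨l₀, μ, W, hW, hl₀, hμ, hX⟩, -⟩, hl, hν, hY⟩, -⟩ := hY
  obtain ⟨l', -, hl', hr⟩ := exists_restricts_comp
    (fun e => exists_restricts_of_isFlowMapOf_hat) l hl
  refine ⟨l₀ ++ l', ν * μ, W, hW, fun f hf => ?_, mul_pos hν hμ, ?_⟩
  · rcases List.mem_append.1 hf with hf | hf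
    exacts [hl₀ f hf, hl' f hf]
  · rw [comp_append]
    exact (hY.mono hr).trans hX
      (IsLocalDiffeo.comp fun f hf => (hl' f hf).isLocalDiffeo).mdifferentiable
      (IsLocalDiffeo.comp fun f hf => IsFlowMapOf.isLocalDiffeo (hl₀ f hf)).mdifferentiable

lemma mem_hat_of_mem (hbound : ∀ x, ∀ X ∈ S, x ∈ X.dom → jetNorm (φ x) m X x ≤ k x)
    {X : LocalVectorField E M} (hX : X ∈ S) {x : M} (hx : x ∈ X.dom) : X ∈ hat φ k m S :=
  ⟨⟨[], 1, X, hX, by simp, one_pos, IsPushforward.refl X⟩, x, hx, hbound x X hX hx⟩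

lemma pseudogroup_mono {S S' : Set (LocalVectorField E M)}
    (h : ∀ e, IsGenerator φ k s S e →
      ∃ l, l ≠ [] ∧ (∀ f ∈ l, IsGenerator φ k s S' f) ∧ Restricts e (comp l)) :
    pseudogroup φ k s S ⊆ pseudogroup φ k s S' := by
  rintro Ψ ⟨l, hne, hl, h1, h2⟩
  obtain ⟨l', hne', hl', hr⟩ := exists_restricts_comp h l hl
  obtain ⟨h3, h4⟩ := Restricts.trans ⟨h1, h2⟩ hr
  exact ⟨l', hne' hne, hl', h3, h4⟩

lemma pseudogroup_hat [Nonempty M] (hcover : ∀ x, ∃ X ∈ S, x ∈ X.dom)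
    (hbound : ∀ x, ∀ X ∈ S, x ∈ X.dom → jetNorm (φ x) (s + 2) X x ≤ k x) :
    pseudogroup φ k s (hat φ k (s + 2) S) = pseudogroup φ k s S := by
  refine Subset.antisymm (pseudogroup_mono ?_) (pseudogroup_mono ?_)
  · rintro e (he | ⟨ξ, τ, hξ, he⟩)
    · obtain ⟨l, hne, hl, hr⟩ := exists_restricts_of_isFlowMapOf_hat he
      exact ⟨l, hne, fun f hf => Or.inl (hl f hf), hr⟩
    · rw [hat_hat] at hξ
      exact ⟨[e], by simp, fun f hf => List.mem_singleton.1 hf ▸ Or.inr ⟨ξ, τ, hξ, he⟩,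
        by simp [comp, Restricts.refl]⟩
  · intro e he
    refine ⟨[e], by simp, ?_, by simp [comp, Restricts.refl]⟩
    simp only [List.mem_singleton, forall_eq]
    rcases he with ⟨X, hX, t, he⟩ | ⟨ξ, τ, hξ, he⟩
    · rcases X.dom.eq_empty_or_nonempty with h0 | ⟨x, hx⟩
      · obtain ⟨X', hX', hx⟩ := hcover (Classical.arbitrary M)
        refine Or.inl ⟨X', mem_hat_of_mem hbound hX' hx, 0, he.1, fun y hy => ?_⟩
        have := (he.2 y hy).mem_dom.1
        simp [h0] at this
      · exact Or.inl ⟨X, mem_hat_of_mem hbound hX hx, t, he⟩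
    · exact Or.inr ⟨ξ, τ, fun n => subset_hat_hat (hξ n), he⟩

end

/-! ### Concatenation of curves -/

lemma exists_eqOn_Iic_Ici {M : Type*} {γ δ : ℝ → M} {b : ℝ} (h : γ b = δ b) :
    ∃ η : ℝ → M, EqOn η γ (Iic b) ∧ EqOn η δ (Ici b) := by
  refine ⟨fun u => if u ≤ b then γ u else δ u, fun u hu => if_pos hu, fun u hu => ?_⟩
  rcases eq_or_lt_of_le (mem_Ici.1 hu) with rfl | hu
  · simpa using h
  · simp [not_le.2 hu]

section

variable {M : Type*} [TopologicalSpace M]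

/-- `γ : [a, b] → M` is a continuous finite concatenation of pieces with the property `P`. -/
def IsConcat (P : (ℝ → M) → ℝ → ℝ → Prop) (γ : ℝ → M) (a b : ℝ) : Prop :=
  ContinuousOn γ (Icc a b) ∧
  ∃ (n : ℕ) (t : ℕ → ℝ), Monotone t ∧ t 0 = a ∧ t n = b ∧ ∀ i < n, P γ (t i) (t (i + 1))

lemma IsConcat.exists_append {P : (ℝ → M) → ℝ → ℝ → Prop}
    (hP : ∀ γ γ' u v, EqOn γ' γ (Icc u v) → P γ u v → P γ' u v)
    {γ δ : ℝ → M} {a b c : ℝ} (hγ : IsConcat P γ a b) (hab : a ≤ b) (hbc : b ≤ c)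
    (h : γ b = δ b) (hδ : ContinuousOn δ (Icc b c)) (hPδ : P δ b c) :
    ∃ η, IsConcat P η a c ∧ η a = γ a ∧ η c = δ c := by
  obtain ⟨η, h1, h2⟩ := exists_eqOn_Iic_Ici h
  obtain ⟨hc, n, t, ht, rfl, rfl, hn⟩ := hγ
  refine ⟨η, ⟨?_, n + 1, fun i => if i ≤ n then t i else c, ?_, by simp, by simp, ?_⟩,
    h1 hab, h2 hbc⟩
  · rw [← Icc_union_Icc_eq_Icc hab hbc]
    exact (hc.congr (h1.mono Icc_subset_Iic_self)).union_of_isClosed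
      (hδ.congr (h2.mono Icc_subset_Ici_self)) isClosed_Icc isClosed_Icc
  · refine monotone_nat_of_le_succ fun i => ?_
    by_cases h3 : i + 1 ≤ n
    · simp [h3, (Nat.le_succ i).trans h3, ht (Nat.le_succ i)]
    · by_cases h4 : i ≤ n
      · simpa [h3, h4] using (ht h4).trans hbc
      · simp [h3, h4]
  · intro i hi
    rcases Nat.lt_succ_iff_lt_or_eq.1 hi with hi | rfl
    · have h3 : i + 1 ≤ n := hi
      simp only [hi.le, h3, if_true]
      exact hP γ η _ _ (h1.mono fun u hu => hu.2.trans (ht h3)) (hn i hi)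
    · simp only [le_refl, if_true, Nat.not_succ_le_self, if_false]
      exact hP δ η _ _ (h2.mono Icc_subset_Ici_self) hPδ

/-- The starting time `b` in `hR` is arbitrary so that each new piece can be attached where the
previous curve stops. -/
lemma exists_isConcat_of_reflTransGen {P : (ℝ → M) → ℝ → ℝ → Prop}
    (hP : ∀ γ γ' u v, EqOn γ' γ (Icc u v) → P γ u v → P γ' u v) {R : M → M → Prop}
    (hR : ∀ x y, R x y → ∀ b, ∃ (δ : ℝ → M) (c : ℝ), b ≤ c ∧ δ b = x ∧ δ c = y ∧
      ContinuousOn δ (Icc b c) ∧ P δ b c) {x y : M} (h : Relation.ReflTransGen R x y) :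
    ∃ (γ : ℝ → M) (a b : ℝ), a ≤ b ∧ IsConcat P γ a b ∧ γ a = x ∧ γ b = y := by
  induction h with
  | refl =>
    exact ⟨fun _ => x, 0, 0, le_rfl, ⟨continuousOn_const, 0, fun _ => 0, monotone_const, rfl, rfl,
      by simp⟩, rfl, rfl⟩
  | tail _ hyz ih =>
    obtain ⟨γ, a, b, hab, hγ, rfl, rfl⟩ := ih
    obtain ⟨δ, c, hbc, h1, rfl, hδ, hPδ⟩ := hR _ _ hyz b
    obtain ⟨η, h2, h3, h4⟩ := hγ.exists_append hP hab hbc h1.symm hδ hPδ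
    exact ⟨η, a, c, hab.trans hbc, h2, h3, h4⟩

/-- Pieces on consecutive intervals that accumulate at a point form a continuous curve. -/
lemma exists_continuousOn_of_pieces [T2Space M] {t : ℕ → ℝ} {b : ℝ} {p : ℕ → M} {y : M}
    {δ : ℕ → ℝ → M} (ht : Monotone t) (htb : Tendsto t atTop (𝓝 b)) (hp : Tendsto p atTop (𝓝 y))
    (h0 : ∀ n, δ n (t n) = p n) (h1 : ∀ n, δ n (t (n + 1)) = p (n + 1))
    (hδ : ∀ n, ContinuousOn (δ n) (Icc (t n) (t (n + 1))))
    (hlim : ∀ U ∈ 𝓝 y, ∀ᶠ n in atTop, ∀ u ∈ Icc (t n) (t (n + 1)), δ n u ∈ U) :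
    ∃ γ : ℝ → M, ContinuousOn γ (Icc (t 0) b) ∧ γ (t 0) = p 0 ∧ γ b = y ∧
      ∀ n, EqOn γ (δ n) (Icc (t n) (t (n + 1))) := by
  classical
  have hle : ∀ n, t n ≤ b := fun n => ht.ge_of_tendsto htb n
  -- Pieces of length zero are allowed; while the times stall, the points `p` do not move.
  have hconst : ∀ m n, m ≤ n → t m = t n → p m = p n := by
    intro m n hmn
    induction n, hmn using Nat.le_induction with
    | base => exact fun _ => rfl
    | succ n hmn ih =>
      intro h
      have h2 : t m = t n := le_antisymm (ht hmn) (h ▸ ht (Nat.le_succ n))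
      rw [ih h2, ← h0 n, ← h1 n, ← h2, h]
  -- The piece used at `u` is the first that ends strictly after `u`. The default value `y` is what
  -- makes `γ b = y`.
  let γ : ℝ → M := fun u => if h : ∃ n, u < t (n + 1) then δ (Nat.find h) u else y
  have hb : γ b = y := dif_neg fun ⟨n, hn⟩ => absurd (hle _) (not_le.2 hn)
  have hIco : ∀ n, EqOn γ (δ n) (Ico (t n) (t (n + 1))) := by
    intro n u hu
    have h : ∃ n, u < t (n + 1) := ⟨n, hu.2⟩
    have hn : Nat.find h = n := by
      rw [Nat.find_eq_iff]
      exact ⟨hu.2, fun m hm => not_lt.2 ((ht (Nat.succ_le_of_lt hm)).trans hu.1)⟩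
    simp only [γ, dif_pos h, hn]
  have hγt : ∀ n, γ (t n) = p n := by
    intro n
    by_cases h : ∃ k, t n < t (k + 1)
    · have h2 := Nat.find_spec h
      set k := Nat.find h with hk
      have h3 : n ≤ k := by
        by_contra hlt
        exact absurd (ht (Nat.succ_le_of_lt (not_le.1 hlt))) (not_le.2 h2)
      have h4 : t k ≤ t n := by
        rcases Nat.eq_zero_or_pos k with h5 | h5
        · exact ht (by omega)
        · have := Nat.find_min h (m := k - 1) (by omega)
          rwa [Nat.sub_add_cancel h5, not_lt] at this
      have h5 : t n = t k := le_antisymm (ht h3) h4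
      rw [hIco k ⟨h4, h2⟩, h5, h0, hconst n k h3 h5]
    -- The times are constant from `n` on, hence so is `p`, and its limit `y` is already `p n`.
    · push Not at h
      have h2 : ∀ k, n ≤ k → p k = p n := fun k hk =>
        (hconst n k hk (le_antisymm (ht hk) ((ht (Nat.le_succ k)).trans (h k)))).symm
      have h3 : y = p n := tendsto_nhds_unique hp
        (tendsto_const_nhds.congr' (eventually_atTop.2 ⟨n, fun k hk => (h2 k hk).symm⟩))
      rw [← h3]
      exact dif_neg fun ⟨k, hk⟩ => absurd (h k) (not_le.2 hk)
  have hIcc : ∀ n, EqOn γ (δ n) (Icc (t n) (t (n + 1))) := by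
    intro n u hu
    rcases eq_or_lt_of_le hu.2 with rfl | h
    · rw [hγt, h1]
    · exact hIco n ⟨hu.1, h⟩
  have hfin : ∀ n, ContinuousOn γ (Icc (t 0) (t n)) := by
    intro n
    induction n with
    | zero => simp
    | succ n ih =>
      rw [← Icc_union_Icc_eq_Icc (ht (Nat.zero_le n)) (ht (Nat.le_succ n))]
      exact ih.union_of_isClosed ((hδ n).congr (hIcc n)) isClosed_Icc isClosed_Icc
  refine ⟨γ, ?_, hγt 0, hb, hIcc⟩
  -- If `b` is attained, finitely many pieces cover the interval. Otherwise continuity at `b` is the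
  -- shrinking condition `hlim`.
  by_cases hfx : ∃ n, t n = b
  · obtain ⟨n, hn⟩ := hfx
    exact hn ▸ hfin n
  have hlt : ∀ n, t n < b := fun n => lt_of_le_of_ne (hle n) fun h => hfx ⟨n, h⟩
  intro u hu
  rcases eq_or_lt_of_le hu.2 with rfl | hub
  · rw [ContinuousWithinAt, hb]
    refine fun U hU => ?_
    obtain ⟨N, hN⟩ := eventually_atTop.1 (hlim U hU)
    have : Ioi (t N) ∩ Icc (t 0) u ∈ 𝓝[Icc (t 0) u] u :=
      
      inter_mem (mem_nhdsWithin_of_mem_nhds (Ioi_mem_nhds (hlt N))) self_mem_nhdsWithin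
    refine mem_map.2 (mem_of_superset this fun v hv => ?_)
    rcases eq_or_lt_of_le hv.2.2 with rfl | hvb
    · exact mem_preimage.2 (hb.symm ▸ mem_of_mem_nhds hU)
    · have hex : ∃ k, v < t (k + 1) := by
        obtain ⟨k, hk⟩ := (htb.eventually_const_lt hvb).exists
        exact ⟨k, hk.trans_le (ht (Nat.le_succ k))⟩
      have h2 := Nat.find_spec hex
      set k := Nat.find hex with hk
      have h3 : N ≤ k := by
        by_contra hlt
        exact absurd ((ht (Nat.succ_le_of_lt (not_le.1 hlt))).trans hv.1.le) (not_le.2 h2)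
      have h4 : t k ≤ v := by
        rcases Nat.eq_zero_or_pos k with h5 | h5
        · rw [h5]; exact hv.2.1
        · have := Nat.find_min hex (m := k - 1) (by omega)
          rwa [Nat.sub_add_cancel h5, not_lt] at this
      rw [mem_preimage, hIcc k ⟨h4, h2.le⟩]
      exact hN k h3 v ⟨h4, h2.le⟩
  · obtain ⟨n, hn⟩ := (htb.eventually_const_lt hub).exists
    refine (hfin n u ⟨hu.1, hn.le⟩).mono_of_mem_nhdsWithin ?_
    refine mem_of_superset (inter_mem_nhdsWithin _ (Iio_mem_nhds hn)) fun v hv => ?_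
    exact ⟨hv.1.1, (mem_Iio.1 hv.2).le⟩

end

/-! ### Congruence and reparametrization of integral curves; flow steps -/

section

variable {E M : Type*} [NormedAddCommGroup E] [NormedSpace ℝ E]
  [TopologicalSpace M] [ChartedSpace E M]

lemma isMIntegralCurveOn_congr {γ γ' : ℝ → M} {v : (x : M) → TangentSpace 𝓘(ℝ, E) x} {J : Set ℝ}
    (h : EqOn γ' γ J) (hγ : IsMIntegralCurveOn γ v J) : IsMIntegralCurveOn γ' v J := by
  intro u hu
  have h1 := (hγ u hu).congr_mono h (h hu) Subset.rfl
  refine HasMFDerivWithinAt.congr_mfderiv h1 ?_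
  -- The two vectors lie in tangent spaces at different base points; all of these are `E` by
  -- definition, where the equality can be stated.
  have h2 : (v (γ' u) : E) = v (γ u) := congrArg (fun x => (v x : E)) (h hu)
  exact congrArg (fun w : E => (1 : ℝ →L[ℝ] ℝ).smulRight w) h2.symm

lemma isMIntegralCurveOn_continuousOn {γ : ℝ → M} {v : (x : M) → TangentSpace 𝓘(ℝ, E) x}
    {J : Set ℝ} (hγ : IsMIntegralCurveOn γ v J) : ContinuousOn γ J :=
  fun u hu => (hγ u hu).continuousWithinAt

variable [IsManifold 𝓘(ℝ, E) ∞ M]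

/-- `v` is the vector field `X` or `-X`. -/
def IsFieldUpToSign (X : LocalVectorField E M) (v : (x : M) → TangentSpace 𝓘(ℝ, E) x) : Prop :=
  v = X.toFun ∨ v = fun x => -(X.toFun x)

lemma isTangentPiece_iff {ξ : Set (LocalVectorField E M)} {γ : ℝ → M} {J : Set ℝ} :
    IsTangentPiece ξ γ J ↔ ∃ X ∈ ξ, ∃ v, IsFieldUpToSign X v ∧ (∀ t ∈ J, γ t ∈ X.dom) ∧
      IsMIntegralCurveOn γ v J := by
  constructor
  · rintro ⟨X, hX, h | h⟩
    exacts [⟨X, hX, _, Or.inl rfl, h.1, h.2⟩, ⟨X, hX, _, Or.inr rfl, h.1, h.2⟩]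
  · rintro ⟨X, hX, v, rfl | rfl, h⟩
    exacts [⟨X, hX, Or.inl h⟩, ⟨X, hX, Or.inr h⟩]

lemma IsTangentPiece.congr {ξ : Set (LocalVectorField E M)} {γ γ' : ℝ → M} {J : Set ℝ}
    (hγ : IsTangentPiece ξ γ J) (h : EqOn γ' γ J) : IsTangentPiece ξ γ' J := by
  rw [isTangentPiece_iff] at hγ ⊢
  obtain ⟨X, hX, v, hv, h1, h2⟩ := hγ
  exact ⟨X, hX, v, hv, fun t ht => (h ht).symm ▸ h1 t ht, isMIntegralCurveOn_congr h h2⟩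

lemma IsTangentPiece.mono {ξ : Set (LocalVectorField E M)} {γ : ℝ → M} {J J' : Set ℝ}
    (hγ : IsTangentPiece ξ γ J) (h : J' ⊆ J) : IsTangentPiece ξ γ J' := by
  rw [isTangentPiece_iff] at hγ ⊢
  obtain ⟨X, hX, v, hv, h1, h2⟩ := hγ
  exact ⟨X, hX, v, hv, fun t ht => h1 t (h ht), h2.mono h⟩

lemma IsL1IntegralCurve.congr {ξ : Set (LocalVectorField E M)} {γ γ' : ℝ → M} {a b : ℝ}
    (hγ : IsL1IntegralCurve ξ γ a b) (h : EqOn γ' γ (Icc a b)) :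
    IsL1IntegralCurve ξ γ' a b := by
  obtain ⟨hc, t, ht, rfl, htb, hp⟩ := hγ
  refine ⟨hc.congr h, t, ht, rfl, htb, fun i hi => (hp i hi).congr (h.mono fun u hu => ?_)⟩
  exact ⟨(ht (Nat.zero_le i)).trans hu.1.le, hu.2.le.trans (ht.ge_of_tendsto htb _)⟩

/-- A flow trajectory, run forwards in time from an arbitrary starting time. -/
lemma FlowRel.exists_curve {X : LocalVectorField E M} {t : ℝ} {x y : M} (h : FlowRel X t x y)
    (b : ℝ) : ∃ (δ : ℝ → M) (v : (x : M) → TangentSpace 𝓘(ℝ, E) x), IsFieldUpToSign X v ∧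
      δ b = x ∧ δ (b + |t|) = y ∧ (∀ u ∈ Icc b (b + |t|), δ u ∈ X.dom) ∧
      IsMIntegralCurveOn δ v (Icc b (b + |t|)) := by
  obtain ⟨γ, rfl, rfl, hγ⟩ := h
  rcases le_total 0 t with ht | ht
  · rw [abs_of_nonneg ht]
    have hs : Icc b (b + t) ⊆ {u | u + (-b) ∈ uIcc 0 t} := fun u hu => by
      rw [mem_ofPred_eq, uIcc_of_le ht]
      constructor <;> linarith [hu.1, hu.2]
    exact ⟨γ ∘ (· + (-b)), X.toFun, Or.inl rfl, by simp, by simp, fun u hu => hγ.1 _ (hs hu),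
      (hγ.2.comp_add (-b)).mono hs⟩
  · rw [abs_of_nonpos ht]
    have hs : Icc b (b + -t) ⊆ {u | u + (-b) ∈ {w | w * (-1) ∈ uIcc 0 t}} := fun u hu => by
      simp only [mem_ofPred_eq]
      rw [uIcc_of_ge ht]
      constructor <;> linarith [hu.1, hu.2]
    refine ⟨(γ ∘ (· * (-1))) ∘ (· + (-b)), fun x => -(X.toFun x), Or.inr rfl, by simp, by simp,
      fun u hu => hγ.1 _ (hs hu), ?_⟩
    have := ((hγ.2.comp_mul (-1)).comp_add (-b)).mono hs
    rwa [neg_one_smul] at this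

/-- `y` is on the flow trajectory through `x` of some element of `S`. -/
def FlowStep (S : Set (LocalVectorField E M)) (x y : M) : Prop :=
  ∃ X ∈ S, ∃ t, FlowRel X t x y

lemma FlowStep.symm {S : Set (LocalVectorField E M)} {x y : M} (h : FlowStep S x y) :
    FlowStep S y x :=
  let ⟨X, hX, t, h⟩ := h
  ⟨X, hX, -t, h.symm⟩

/-- Converse of `FlowRel.exists_curve`: a trajectory of `-X` for time `T` is one of `X` for time
`-T`. -/
lemma FlowStep.of_curve {S : Set (LocalVectorField E M)} {X : LocalVectorField E M} (hX : X ∈ S)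
    {v : (x : M) → TangentSpace 𝓘(ℝ, E) x} (hv : IsFieldUpToSign X v) {γ : ℝ → M} {T : ℝ}
    (hT : 0 ≤ T) (hd : ∀ u ∈ Icc 0 T, γ u ∈ X.dom) (hγ : IsMIntegralCurveOn γ v (Icc 0 T)) :
    FlowStep S (γ 0) (γ T) := by
  rcases hv with rfl | rfl
  · exact ⟨X, hX, T, γ, rfl, rfl, by rwa [uIcc_of_le hT], by rwa [uIcc_of_le hT]⟩
  · have hs : uIcc 0 (-T) ⊆ {w | w * (-1) ∈ Icc 0 T} := fun u hu => by
      rw [uIcc_of_ge (by linarith)] at hu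
      constructor <;> linarith [hu.1, hu.2]
    refine ⟨X, hX, -T, γ ∘ (· * (-1)), by simp, by simp, fun u hu => hd _ (hs hu), ?_⟩
    have := (hγ.comp_mul (-1)).mono hs
    rw [neg_one_smul] at this
    convert this using 1
    funext x
    simp

lemma exists_isPiecewiseSmoothCurve {S : Set (LocalVectorField E M)} {x y : M}
    (h : Relation.ReflTransGen (FlowStep S) x y) : ∃ (γ : ℝ → M) (a b : ℝ), a ≤ b ∧
      IsPiecewiseSmoothCurve S γ a b ∧ γ a = x ∧ γ b = y := by
  refine exists_isConcat_of_reflTransGen (P := fun γ u v => IsTangentPiece S γ (Icc u v))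
    (fun γ γ' u v h hγ => hγ.congr h) (fun x y hxy b => ?_) h
  obtain ⟨X, hX, t, hxy⟩ := hxy
  obtain ⟨δ, v, hv, h1, h2, h3, h4⟩ := hxy.exists_curve b
  exact ⟨δ, b + |t|, by linarith [abs_nonneg t], h1, h2, isMIntegralCurveOn_continuousOn h4,
    isTangentPiece_iff.2 ⟨X, hX, v, hv, h3, h4⟩⟩

/-- From every starting time, there is an `l¹`-integral curve from `x` to `y`. -/
def L1Step (S : Set (LocalVectorField E M)) (x y : M) : Prop :=
  ∀ b : ℝ, ∃ (δ : ℝ → M) (c : ℝ), b ≤ c ∧ δ b = x ∧ δ c = y ∧ IsL1IntegralCurve S δ b c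

lemma exists_isL1Curve {S : Set (LocalVectorField E M)} {x y : M}
    (h : Relation.ReflTransGen (fun x y => L1Step S x y ∨ L1Step S y x) x y) :
    ∃ (γ : ℝ → M) (a b : ℝ), a ≤ b ∧ IsL1Curve S γ a b ∧ γ a = x ∧ γ b = y := by
  refine exists_isConcat_of_reflTransGen (P := fun γ u v => IsL1IntegralCurve S γ u v ∨
      IsL1IntegralCurve S (fun s => γ (u + v - s)) u v)
    (fun γ γ' u v h hγ => hγ.imp (fun hγ => hγ.congr h) fun hγ => hγ.congr fun s hs =>
      h ⟨by linarith [hs.1, hs.2], by linarith [hs.1, hs.2]⟩) (fun x y hxy b => ?_) h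
  rcases hxy with hxy | hxy
  · obtain ⟨δ, c, hbc, h1, h2, h3⟩ := hxy b
    exact ⟨δ, c, hbc, h1, h2, h3.1, Or.inl h3⟩
  · obtain ⟨δ, c, hbc, h1, h2, h3⟩ := hxy b
    refine ⟨fun s => δ (b + c - s), c, hbc, by simpa using h2, by simpa using h1, ?_, Or.inr ?_⟩
    · refine h3.1.comp (by fun_prop) fun s hs => ?_
      constructor <;> linarith [hs.1, hs.2]
    · simpa using h3

end

/-! ### Trajectories of a bounded Lipschitz vector field on a ball -/

section

variable {E : Type*} [NormedAddCommGroup E] [NormedSpace ℝ E]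

/-- `α` is a solution of `α' = f(α)` on `J` with values in `B`. -/
def IsSolutionIn (f : E → E) (B : Set E) (α : ℝ → E) (J : Set ℝ) : Prop :=
  ∀ u ∈ J, α u ∈ B ∧ HasDerivWithinAt α (f (α u)) J u

lemma IsSolutionIn.continuousOn {f : E → E} {B : Set E} {α : ℝ → E} {J : Set ℝ}
    (h : IsSolutionIn f B α J) : ContinuousOn α J :=
  fun u hu => (h u hu).2.continuousWithinAt

lemma IsSolutionIn.hasDerivWithinAt_Ici {f : E → E} {B : Set E} {α : ℝ → E} {a b u : ℝ}
    (h : IsSolutionIn f B α (Icc a b)) (hu : u ∈ Ico a b) :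
    HasDerivWithinAt α (f (α u)) (Ici u) u :=
  (h u ⟨hu.1, hu.2.le⟩).2.mono_of_mem_nhdsWithin (Icc_mem_nhdsGE_of_mem hu)

lemma IsSolutionIn.comp_const_add {f : E → E} {B : Set E} {α : ℝ → E} {J J' : Set ℝ} {d : ℝ}
    (h : IsSolutionIn f B α J) (hJ : MapsTo (d + ·) J' J) :
    IsSolutionIn f B (fun u => α (d + u)) J' := by
  intro u hu
  refine ⟨(h _ (hJ hu)).1, ?_⟩
  have := (h _ (hJ hu)).2.scomp u ((hasDerivAt_id u).const_add d).hasDerivWithinAt hJ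
  rwa [one_smul] at this

lemma IsSolutionIn.mono {f : E → E} {B B' : Set E} {α : ℝ → E} {J : Set ℝ}
    (h : IsSolutionIn f B α J) (hB : B ⊆ B') : IsSolutionIn f B' α J :=
  fun u hu => ⟨hB (h u hu).1, (h u hu).2⟩

variable [CompleteSpace E]

/-- Picard–Lindelöf, redone from the fixed point of the Picard operator in order to keep the
information that the solution stays in the closed ball. -/
lemma exists_isSolutionIn {f : E → E} {x : E} {η c : NNReal} {h : ℝ} (hh : 0 ≤ h)
    (hb : ∀ z ∈ Metric.closedBall x η, ‖f z‖ ≤ c)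
    (hl : LipschitzOnWith c f (Metric.closedBall x η)) (hc : c * h ≤ η) :
    ∃ α : ℝ → E, α 0 = x ∧ IsSolutionIn f (Metric.closedBall x η) α (Icc 0 h) := by
  have hPL : IsPicardLindelof (fun _ => f) (tmin := 0) (tmax := h) ⟨0, le_rfl, hh⟩ x η 0 c c :=
    IsPicardLindelof.of_time_independent hb hl (by simpa [hh] using hc)
  have hx : x ∈ Metric.closedBall x ((0 : NNReal) : ℝ) := by simp
  obtain ⟨α, hα⟩ := ODE.FunSpace.exists_isFixedPt_next hPL hx
  have hmem : ∀ u, α.compProj u ∈ Metric.closedBall x (η : ℝ) := fun u =>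
    α.compProj_mem_closedBall hPL.mul_max_le
  refine ⟨α.compProj, ?_, fun u hu => ⟨hmem u, ?_⟩⟩
  · have : α.compProj ((⟨0, le_rfl, hh⟩ : Icc (0 : ℝ) h) : ℝ) = x := by
      rw [ODE.FunSpace.compProj_val, ← hα, ODE.FunSpace.next_apply₀]
    exact this
  · refine (ODE.hasDerivWithinAt_picard_Icc (f := fun _ => f) (t₀ := 0) ⟨le_rfl, hh⟩
      hPL.continuousOn_uncurry α.continuous_compProj.continuousOn (fun u _ => hmem u) x
      hu).congr_of_mem (fun w hw => ?_) hu
    nth_rw 1 [← hα]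
    rw [ODE.FunSpace.compProj_of_mem hw, ODE.FunSpace.next_apply]

/-- `z'` is the end of a trajectory of `f` in `B` with origin `z`. -/
def TrajectoryStep (f : E → E) (B : Set E) (z z' : E) : Prop :=
  ∃ (h : ℝ) (α : ℝ → E), 0 ≤ h ∧ α 0 = z ∧ α h = z' ∧ IsSolutionIn f B α (Icc 0 h)

/-- A point close to the origin of a trajectory `σ` can be moved along trajectories to a point
close to the end of `σ`. -/
lemma exists_trajectory_near {f : E → E} {R ρ T : ℝ} {c : NNReal} {σ : ℝ → E} (hρ : ρ < R)
    (hT : 0 ≤ T) (hb : ∀ z ∈ Metric.closedBall 0 R, ‖f z‖ ≤ c)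
    (hl : LipschitzOnWith c f (Metric.closedBall 0 R))
    (hσ : IsSolutionIn f (Metric.closedBall 0 ρ) σ (Icc 0 T)) {z : E}
    -- The margin bounds the final error, hence the error at every intermediate time.
    (hz : dist z (σ 0) * Real.exp (c * T) ≤ (R - ρ) / 2) :
    ∃ z', dist z' (σ T) ≤ dist z (σ 0) * Real.exp (c * T) ∧
      Relation.ReflTransGen (TrajectoryStep f (Metric.closedBall 0 R)) z z' := by
  -- One `η` is for the distance to `σ`, which stays in radius `ρ`, and one for the radius of a
  -- Picard step; together they just fit in radius `R`.
  set η : ℝ := (R - ρ) / 2 with hη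
  have hη0 : 0 < η := by linarith
  obtain ⟨N, hN⟩ := exists_nat_gt (c * T / η)
  have hN0 : (0 : ℝ) < N := lt_of_le_of_lt (by positivity) hN
  -- The time step is short enough (`c * h ≤ η`) for Picard–Lindelöf on a ball of radius `η`.
  set h : ℝ := T / N with hh
  have hh0 : 0 ≤ h := by positivity
  have hNh : N * h = T := by rw [hh]; field_simp
  have hch : c * h ≤ η := by
    rw [div_lt_iff₀ hη0] at hN
    rw [hh, ← mul_div_assoc, div_le_iff₀ hN0]
    linarith
  have key : ∀ i : ℕ, i ≤ N → ∃ z', dist z' (σ (i * h)) ≤ dist z (σ 0) * Real.exp (c * (i * h)) ∧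
      Relation.ReflTransGen (TrajectoryStep f (Metric.closedBall 0 R)) z z' := by
    intro i
    induction i with
    | zero => exact fun _ => ⟨z, by simp, Relation.ReflTransGen.refl⟩
    | succ i ih =>
      intro hi
      obtain ⟨w, hw, hzw⟩ := ih (by omega)
      have hi' : (i + 1 : ℝ) ≤ N := by exact_mod_cast hi
      have hih : (i + 1 : ℝ) * h ≤ T := hNh ▸ mul_le_mul_of_nonneg_right hi' hh0
      have hih0 : 0 ≤ i * h := by positivity
      have hmaps : MapsTo (i * h + ·) (Icc 0 h) (Icc 0 T) := fun u hu =>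
        ⟨by linarith [hu.1], by linarith [hu.2]⟩
      have hσ' := hσ.comp_const_add hmaps
      have hwη : dist w (σ (i * h)) ≤ η := by
        refine hw.trans (le_trans ?_ hz)
        gcongr
        linarith
      have hσi : σ (i * h) ∈ Metric.closedBall 0 ρ := by
        simpa using (hσ' 0 ⟨le_rfl, hh0⟩).1
      have hball : Metric.closedBall w η ⊆ Metric.closedBall 0 R := by
        refine Metric.closedBall_subset_closedBall' ?_
        have := dist_triangle w (σ (i * h)) 0
        rw [Metric.mem_closedBall] at hσi
        linarith
      obtain ⟨α, hα0, hα⟩ := exists_isSolutionIn (f := f) (x := w) (η := ⟨η, hη0.le⟩) (c := c) hh0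
        (fun z hz => hb z (hball hz)) (hl.mono hball) hch
      have hα' := hα.mono hball
      refine ⟨α h, ?_, hzw.tail ⟨h, α, hh0, hα0, rfl, hα'⟩⟩
      have hσR := hσ'.mono (Metric.closedBall_subset_closedBall (x := (0 : E)) hρ.le)
      -- Grönwall: each time step multiplies the error by at most `exp(c h)`.
      have hg := dist_le_of_trajectories_ODE_of_mem (v := fun _ => f)
        (s := fun _ => Metric.closedBall 0 R) (fun _ _ => hl) hα'.continuousOn
        (fun u hu => hα'.hasDerivWithinAt_Ici hu) (fun u hu => (hα' u ⟨hu.1, hu.2.le⟩).1)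
        hσR.continuousOn (fun u hu => hσR.hasDerivWithinAt_Ici hu)
        (fun u hu => (hσR u ⟨hu.1, hu.2.le⟩).1) le_rfl h ⟨hh0, le_rfl⟩
      have e1 : ((i + 1 : ℕ) : ℝ) * h = i * h + h := by push_cast; ring
      rw [e1]
      refine hg.trans ?_
      rw [hα0, add_zero, sub_zero, mul_add, Real.exp_add, ← mul_assoc]
      gcongr
  obtain ⟨z', h1, h2⟩ := key N le_rfl
  rw [hNh] at h1
  exact ⟨z', h1, h2⟩

end

/-! ### Vector fields and integral curves read in a chart -/

section

variable {E M : Type*} [NormedAddCommGroup E] [NormedSpace ℝ E]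
  [TopologicalSpace M] [ChartedSpace E M]

/-- The vector field `v` read in the chart `ψ`, as a function on `M`. -/
noncomputable def chartVelocity (ψ : OpenPartialHomeomorph M E) (v : (x : M) → TangentSpace 𝓘(ℝ, E) x) (x : M) :
    E :=
  mfderiv 𝓘(ℝ, E) 𝓘(ℝ, E) ψ x (v x)

lemma hasDerivWithinAt_chart_comp {ψ : OpenPartialHomeomorph M E}
    (hψ : ψ.MDifferentiable 𝓘(ℝ, E) 𝓘(ℝ, E)) {γ : ℝ → M}
    {v : (x : M) → TangentSpace 𝓘(ℝ, E) x} {J : Set ℝ} (hγ : IsMIntegralCurveOn γ v J) {u : ℝ}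
    (hu : u ∈ J) (hs : γ u ∈ ψ.source) :
    HasDerivWithinAt (ψ ∘ γ) (chartVelocity ψ v (γ u)) J u := by
  have h := (hψ.mdifferentiableAt hs).hasMFDerivAt.comp_hasMFDerivWithinAt u (hγ u hu)
  have h1 : HasMFDerivWithinAt 𝓘(ℝ, ℝ) 𝓘(ℝ, E) (ψ ∘ γ) J u
      ((1 : ℝ →L[ℝ] ℝ).smulRight (chartVelocity (E := E) ψ v (γ u))) := by
    refine HasMFDerivWithinAt.congr_mfderiv h ?_
    ext
    refine (congrArg (mfderiv 𝓘(ℝ, E) 𝓘(ℝ, E) ψ (γ u)) (one_smul ℝ (v (γ u)))).trans ?_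
    exact (one_smul ℝ (chartVelocity (E := E) ψ v (γ u))).symm
  have h2 : HasFDerivWithinAt (ψ ∘ γ)
      ((1 : ℝ →L[ℝ] ℝ).smulRight (chartVelocity (E := E) ψ v (γ u)) : ℝ →L[ℝ] E) J u :=
    hasMFDerivWithinAt_iff_hasFDerivWithinAt.1 h1
  simpa using h2.hasDerivWithinAt

lemma isMIntegralCurveOn_chart_symm_comp {ψ : OpenPartialHomeomorph M E}
    (hψ : ψ.MDifferentiable 𝓘(ℝ, E) 𝓘(ℝ, E)) {σ : ℝ → E}
    {v : (x : M) → TangentSpace 𝓘(ℝ, E) x} {J : Set ℝ}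
    (hσ : IsSolutionIn (fun z => chartVelocity ψ v (ψ.symm z)) ψ.target σ J) :
    IsMIntegralCurveOn (ψ.symm ∘ σ) v J := by
  intro u hu
  obtain ⟨ht, hd⟩ := hσ u hu
  have h := (hψ.symm.mdifferentiableAt ht).hasMFDerivAt.comp_hasMFDerivWithinAt u
    hd.hasFDerivWithinAt.hasMFDerivWithinAt
  refine HasMFDerivWithinAt.congr_mfderiv h ?_
  ext
  have h2 := hψ.symm_comp_deriv (ψ.map_target ht)
  rw [ψ.right_inv ht] at h2
  have h3 := congrArg (fun L : E →L[ℝ] E => L (v (ψ.symm (σ u)))) h2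
  have h4 : mfderiv 𝓘(ℝ, E) 𝓘(ℝ, E) ψ.symm (σ u) (chartVelocity (E := E) ψ v (ψ.symm (σ u))) =
      v (ψ.symm (σ u)) := h3
  have h5 := one_smul ℝ (chartVelocity ψ v (ψ.symm (σ u)))
  exact (congrArg (mfderiv 𝓘(ℝ, E) 𝓘(ℝ, E) ψ.symm (σ u)) h5).trans
    (h4.trans (one_smul ℝ (v (ψ.symm (σ u)))).symm)

/-- A curve whose speed in a chart is at most `c` cannot leave the chart within the time `T` if the
image of the chart contains the closed ball of radius `c T` around the origin of the curve. -/
lemma mem_source_of_isMIntegralCurveOn [T2Space M] [CompleteSpace E]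
    {ψ : OpenPartialHomeomorph M E} (hψ : ψ.MDifferentiable 𝓘(ℝ, E) 𝓘(ℝ, E)) {γ : ℝ → M}
    {v : (x : M) → TangentSpace 𝓘(ℝ, E) x} {a b : ℝ} (hγ : IsMIntegralCurveOn γ v (Icc a b))
    {c : NNReal}
    (hc : ∀ u ∈ Icc a b, γ u ∈ ψ.source →
      ‖chartVelocity ψ v (γ u)‖ ≤ c)
    (ha : γ a ∈ ψ.source) (hball : Metric.closedBall (ψ (γ a)) (c * (b - a)) ⊆ ψ.target) :
    ∀ u ∈ Icc a b, γ u ∈ ψ.source ∧ dist (ψ (γ u)) (ψ (γ a)) ≤ c * (u - a) := by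
  have hcont := isMIntegralCurveOn_continuousOn hγ
  have hlip : ∀ J : Set ℝ, Convex ℝ J → J ⊆ Icc a b → (∀ u ∈ J, γ u ∈ ψ.source) →
      LipschitzOnWith c (ψ ∘ γ) J := by
    intro J hJ hJs hJψ
    refine hJ.lipschitzOnWith_of_nnnorm_hasDerivWithin_le
      (fun u hu => (hasDerivWithinAt_chart_comp hψ hγ (hJs hu) (hJψ u hu)).mono hJs)
      fun u hu => ?_
    exact hc u (hJs hu) (hJψ u hu)
  have hdist : ∀ w ∈ Icc a b, (∀ u ∈ Icc a w, γ u ∈ ψ.source) →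
      dist (ψ (γ w)) (ψ (γ a)) ≤ c * (w - a) := by
    intro w hw h
    have := (hlip (Icc a w) (convex_Icc a w) (Icc_subset_Icc_right hw.2) h).dist_le_mul w
      ⟨hw.1, le_rfl⟩ a ⟨le_rfl, hw.1⟩
    rwa [Real.dist_eq, abs_of_nonneg (by linarith [hw.1])] at this
  -- Continuous induction on the time up to which the curve stays in the chart.
  have hsub : Icc a b ⊆ {w | ∀ u ∈ Icc a w, γ u ∈ ψ.source} := by
    refine IsClosed.Icc_subset_of_forall_mem_nhdsWithin ?_ ?_ ?_
    · refine isClosed_of_closure_subset fun w hw => ?_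
      have hwI : w ∈ Icc a b := isClosed_Icc.closure_subset_iff.2 inter_subset_right hw
      have hlt : ∀ u ∈ Ico a w, γ u ∈ ψ.source := by
        intro u hu
        obtain ⟨w', h1, h2⟩ := mem_closure_iff_nhds.1 hw _ (Ioi_mem_nhds hu.2)
        exact h2.1 u ⟨hu.1, (mem_Ioi.1 h1).le⟩
      refine ⟨fun u hu => ?_, hwI⟩
      rcases eq_or_lt_of_le hu.2 with rfl | huw
      swap
      · exact hlt u ⟨hu.1, huw⟩
      rcases eq_or_lt_of_le hu.1 with rfl | hau
      · exact ha
      have hl := hlip (Ico a u) (convex_Ico a u) (fun x hx => ⟨hx.1, hx.2.le.trans hwI.2⟩) hlt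
      obtain ⟨q, -, hq, hqlim⟩ := exists_seq_strictMono_tendsto' hau
      have hqI : ∀ n, q n ∈ Ico a u := fun n => ⟨(hq n).1.le, (hq n).2⟩
      -- Before time `u` the curve is Lipschitz in the chart, so it has a limit `z` there. The
      -- closed ball keeps `z` in the image of the chart, and as `M` is Hausdorff, `γ u` is the
      -- point with coordinate `z`.
      obtain ⟨z, hz⟩ := cauchySeq_tendsto_of_complete
        (hl.cauchySeq_comp hqlim.cauchySeq (range_subset_iff.2 hqI))
      have hzt : z ∈ ψ.target := by
        refine hball (Metric.isClosed_closedBall.mem_of_tendsto hz (Eventually.of_forall fun n => ?_))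
        have := hdist (q n) ⟨(hqI n).1, (hqI n).2.le.trans hwI.2⟩
          fun x hx => hlt x ⟨hx.1, hx.2.trans_lt (hqI n).2⟩
        refine this.trans ?_
        gcongr
        exact (hqI n).2.le.trans hwI.2
      have h1 : Tendsto (fun n => γ (q n)) atTop (𝓝 (ψ.symm z)) := by
        refine ((ψ.continuousAt_symm hzt).tendsto.comp hz).congr fun n => ?_
        exact ψ.left_inv (hlt _ (hqI n))
      have h2 : Tendsto (fun n => γ (q n)) atTop (𝓝 (γ u)) :=
        (hcont u hwI).tendsto.comp (tendsto_nhdsWithin_iff.2 ⟨hqlim, Eventually.of_forall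
          fun n => ⟨(hqI n).1, (hqI n).2.le.trans hwI.2⟩⟩)
      rw [tendsto_nhds_unique h2 h1]
      exact ψ.map_target hzt
    · intro u hu
      rwa [le_antisymm hu.2 hu.1]
    · rintro w ⟨hw, hwI⟩
      have hwψ : γ w ∈ ψ.source := hw w ⟨hwI.1, le_rfl⟩
      have h1 : ∀ᶠ x in 𝓝[≥] w, γ x ∈ ψ.source := by
        have h2 : ContinuousWithinAt γ (Ici w) w :=
          (hcont w ⟨hwI.1, hwI.2.le⟩).mono_of_mem_nhdsWithin (Icc_mem_nhdsGE_of_mem hwI)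
        exact h2.eventually_mem (ψ.open_source.mem_nhds hwψ)
      obtain ⟨d, hd, h2⟩ := (mem_nhdsGE_iff_exists_Ico_subset).1 h1
      refine mem_of_superset (Ioo_mem_nhdsGT hd) fun x hx u hu => ?_
      rcases le_total u w with huw | huw
      · exact hw u ⟨hu.1, huw⟩
      · exact h2 ⟨huw, hu.2.trans_lt hx.2⟩
  exact fun u hu => ⟨hsub hu u ⟨hu.1, le_rfl⟩, hdist u hu (hsub hu)⟩

variable [IsManifold 𝓘(ℝ, E) ∞ M]

lemma localRep_apply {ψ : OpenPartialHomeomorph M E} {X : LocalVectorField E M} {y : M}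
    (hy : y ∈ ψ.source) :
    localRep ψ X (ψ y) = chartVelocity ψ X.toFun y := by
  have : ψ.symm (ψ y) = y := ψ.left_inv hy
  change chartVelocity ψ X.toFun (ψ.symm (ψ y)) = _
  rw [this]

/-- On `ψ.target`, the local representative is the fibre component of `Tψ ∘ X ∘ ψ⁻¹`. -/
lemma contDiffOn_localRep {ψ : OpenPartialHomeomorph M E}
    (hψ : ψ ∈ IsManifold.maximalAtlas 𝓘(ℝ, E) ∞ M) {X : LocalVectorField E M}
    (hX : ψ.source ⊆ X.dom) : ContDiffOn ℝ 1 (localRep ψ X) ψ.target := by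
  have h1 : ContMDiffOn 𝓘(ℝ, E).tangent 𝓘(ℝ, E).tangent 1
      (tangentMapWithin 𝓘(ℝ, E) 𝓘(ℝ, E) ψ ψ.source) (Bundle.TotalSpace.proj ⁻¹' ψ.source) :=
    (contMDiffOn_of_mem_maximalAtlas hψ).contMDiffOn_tangentMapWithin (by norm_cast)
      ψ.open_source.uniqueMDiffOn
  have h2 : ContMDiffOn 𝓘(ℝ, E) 𝓘(ℝ, E).tangent 1
      (fun z => (⟨ψ.symm z, X.toFun (ψ.symm z)⟩ : TangentBundle 𝓘(ℝ, E) M)) ψ.target :=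
    (X.smooth.of_le (by norm_cast)).comp
      ((contMDiffOn_symm_of_mem_maximalAtlas hψ).of_le (by norm_cast))
      fun z hz => hX (ψ.map_target hz)
  have h3 := (contMDiff_snd_tangentBundle_modelSpace E 𝓘(ℝ, E)).comp_contMDiffOn
    (h1.comp h2 fun z hz => ψ.map_target hz)
  refine h3.contDiffOn.congr fun z hz => ?_
  have h4 := mfderivWithin_of_isOpen (I := 𝓘(ℝ, E)) (I' := 𝓘(ℝ, E)) (f := ψ) ψ.open_source
    (ψ.map_target hz)
  exact congrArg (fun L : TangentSpace 𝓘(ℝ, E) (ψ.symm z) →L[ℝ]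
    TangentSpace 𝓘(ℝ, E) (ψ (ψ.symm z)) => L (X.toFun (ψ.symm z))) h4.symm

lemma norm_localRep_le {ψ : OpenPartialHomeomorph M E} {X : LocalVectorField E M} {m : ℕ} {y : M} :
    ‖localRep ψ X (ψ y)‖ ≤ jetNorm ψ m X y := by
  rw [← norm_iteratedFDeriv_zero (𝕜 := ℝ)]
  exact Finset.single_le_sum (f := fun i => ‖iteratedFDeriv ℝ i (localRep ψ X) (ψ y)‖)
    (fun _ _ => norm_nonneg _) (by simp)

lemma norm_fderiv_localRep_le {ψ : OpenPartialHomeomorph M E} {X : LocalVectorField E M} {m : ℕ}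
    (hm : 1 ≤ m) {y : M} : ‖fderiv ℝ (localRep ψ X) (ψ y)‖ ≤ jetNorm ψ m X y := by
  rw [← norm_iteratedFDeriv_one]
  exact Finset.single_le_sum (f := fun i => ‖iteratedFDeriv ℝ i (localRep ψ X) (ψ y)‖)
    (fun _ _ => norm_nonneg _) (by simpa using by omega)

/-- Mean value inequality on a convex set; of the jet bound only the first derivative matters here.
-/
lemma lipschitzOnWith_localRep {ψ : OpenPartialHomeomorph M E}
    (hψ : ψ ∈ IsManifold.maximalAtlas 𝓘(ℝ, E) ∞ M) {X : LocalVectorField E M}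
    (hX : ψ.source ⊆ X.dom) {m : ℕ} (hm : 1 ≤ m) {c : NNReal}
    (hc : ∀ y ∈ ψ.source, jetNorm ψ m X y ≤ c) {B : Set E} (hB : Convex ℝ B)
    (hBψ : B ⊆ ψ.target) : LipschitzOnWith c (localRep ψ X) B := by
  refine hB.lipschitzOnWith_of_nnnorm_fderiv_le (𝕜 := ℝ) (fun z hz => ?_) fun z hz => ?_
  · exact ((contDiffOn_localRep hψ hX).differentiableOn (by simp)).differentiableAt
      (ψ.open_target.mem_nhds (hBψ hz))
  · have h := (norm_fderiv_localRep_le (X := X) hm).trans (hc _ (ψ.map_target (hBψ hz)))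
    rwa [ψ.right_inv (hBψ hz)] at h

end

/-! ### Fields controlled in a chart, and their trajectories run backwards -/

section

variable {E : Type*} [NormedAddCommGroup E] [NormedSpace ℝ E]

lemma IsSolutionIn.reverse {f : E → E} {B : Set E} {α : ℝ → E} {a b : ℝ}
    (h : IsSolutionIn f B α (Icc a b)) :
    IsSolutionIn (fun z => -f z) B (fun u => α (a + b - u)) (Icc a b) := by
  have hm : MapsTo (fun u => a + b - u) (Icc a b) (Icc a b) := fun u hu =>
    ⟨by linarith [hu.2], by linarith [hu.1]⟩
  intro u hu
  refine ⟨(h _ (hm hu)).1, ?_⟩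
  have := (h _ (hm hu)).2.scomp u ((hasDerivAt_id u).const_sub (a + b)).hasDerivWithinAt hm
  rwa [neg_one_smul] at this

end

section

variable {E M : Type*} [NormedAddCommGroup E] [NormedSpace ℝ E]
  [TopologicalSpace M] [ChartedSpace E M]

lemma chartVelocity_neg (ψ : OpenPartialHomeomorph M E) (v : (x : M) → TangentSpace 𝓘(ℝ, E) x)
    (x : M) : chartVelocity ψ (fun x => -(v x)) x = -chartVelocity ψ v x :=
  (mfderiv 𝓘(ℝ, E) 𝓘(ℝ, E) ψ x).map_neg (v x)

variable [IsManifold 𝓘(ℝ, E) ∞ M]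

lemma IsFieldUpToSign.neg {X : LocalVectorField E M} {v : (x : M) → TangentSpace 𝓘(ℝ, E) x}
    (h : IsFieldUpToSign X v) : IsFieldUpToSign X (fun x => -(v x)) := by
  rcases h with rfl | rfl
  · exact Or.inr rfl
  · exact Or.inl (funext fun x => neg_neg _)

/-- The field `X` is defined on the domain of the chart `ψ`, whose image contains the closed ball of
radius `R`; read in `ψ`, it is bounded by `c` and `c`-Lipschitz on this ball. -/
structure IsControlled (ψ : OpenPartialHomeomorph M E) (R : ℝ) (c : NNReal)
    (X : LocalVectorField E M) : Prop where
  mem_atlas : ψ ∈ IsManifold.maximalAtlas 𝓘(ℝ, E) ∞ M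
  closedBall_subset : Metric.closedBall 0 R ⊆ ψ.target
  source_subset : ψ.source ⊆ X.dom
  norm_le : ∀ y ∈ ψ.source, ‖chartVelocity ψ X.toFun y‖ ≤ c
  lipschitz : LipschitzOnWith c (fun z => chartVelocity ψ X.toFun (ψ.symm z))
    (Metric.closedBall 0 R)

variable {ψ : OpenPartialHomeomorph M E} {R ρ t : ℝ} {c : NNReal} {X : LocalVectorField E M}
  {v : (x : M) → TangentSpace 𝓘(ℝ, E) x} {x y : M} {S : Set (LocalVectorField E M)}

lemma IsControlled.mdifferentiable (h : IsControlled ψ R c X) :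
    ψ.MDifferentiable 𝓘(ℝ, E) 𝓘(ℝ, E) :=
  mdifferentiable_of_mem_maximalAtlas h.mem_atlas

lemma IsControlled.norm_chartVelocity_le (h : IsControlled ψ R c X) (hv : IsFieldUpToSign X v)
    (hy : y ∈ ψ.source) : ‖chartVelocity ψ v y‖ ≤ c := by
  rcases hv with rfl | rfl
  · exact h.norm_le y hy
  · rw [chartVelocity_neg, norm_neg]
    exact h.norm_le y hy

lemma IsControlled.lipschitzOnWith (h : IsControlled ψ R c X) (hv : IsFieldUpToSign X v) :
    LipschitzOnWith c (fun z => chartVelocity ψ v (ψ.symm z)) (Metric.closedBall 0 R) := by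
  rcases hv with rfl | rfl
  · exact h.lipschitz
  · simp only [chartVelocity_neg]
    exact LipschitzOnWith.of_dist_le_mul fun z hz w hw => by
      rw [dist_neg_neg]
      exact h.lipschitz.dist_le_mul z hz w hw

lemma IsControlled.mem_source_of_curve [T2Space M] [CompleteSpace E] (h : IsControlled ψ R c X)
    (hv : IsFieldUpToSign X v) {δ : ℝ → M} {a b : ℝ}
    (hδ : IsMIntegralCurveOn δ v (Icc a b)) (ha : δ a ∈ ψ.source)
    (hR : ‖ψ (δ a)‖ + c * (b - a) ≤ R) :
    ∀ u ∈ Icc a b, δ u ∈ ψ.source ∧ dist (ψ (δ u)) (ψ (δ a)) ≤ c * (b - a) := by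
  have hb : Metric.closedBall (ψ (δ a)) (c * (b - a)) ⊆ ψ.target :=
    (Metric.closedBall_subset_closedBall' (by rw [dist_zero_right]; linarith)).trans
      h.closedBall_subset
  intro u hu
  obtain ⟨h1, h2⟩ := mem_source_of_isMIntegralCurveOn h.mdifferentiable hδ
    (fun u _ hs => h.norm_chartVelocity_le hv hs) ha hb u hu
  refine ⟨h1, h2.trans ?_⟩
  gcongr
  exact hu.2

lemma IsControlled.flowRel_mem_source [T2Space M] [CompleteSpace E] (h : IsControlled ψ R c X)
    (hxy : FlowRel X t x y) (hx : x ∈ ψ.source) (hR : ‖ψ x‖ + c * |t| ≤ R) :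
    y ∈ ψ.source ∧ dist (ψ y) (ψ x) ≤ c * |t| := by
  obtain ⟨δ, v, hv, rfl, rfl, -, hδ⟩ := hxy.exists_curve 0
  have h0 : (0 : ℝ) ≤ 0 + |t| := by positivity
  have := h.mem_source_of_curve hv hδ hx (by simpa using hR) _ ⟨h0, le_rfl⟩
  simpa using this

lemma IsControlled.flowStep_of_trajectoryStep (h : IsControlled ψ R c X) (hX : X ∈ S)
    (hv : IsFieldUpToSign X v) {z z' : E}
    (hz : TrajectoryStep (fun z => chartVelocity ψ v (ψ.symm z)) (Metric.closedBall 0 R) z z') :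
    FlowStep S (ψ.symm z) (ψ.symm z') := by
  obtain ⟨T, α, hT, rfl, rfl, hα⟩ := hz
  exact FlowStep.of_curve hX hv hT
    (fun u hu => h.source_subset (ψ.map_target (h.closedBall_subset (hα u hu).1)))
    (isMIntegralCurveOn_chart_symm_comp h.mdifferentiable (hα.mono h.closedBall_subset))

/-- A point close to the end of a flow trajectory from `x` can be moved, along trajectories, to a
point close to `x`. -/
lemma IsControlled.exists_flow_back [T2Space M] [CompleteSpace E] (h : IsControlled ψ R c X)
    (hX : X ∈ S) (hxy : FlowRel X t x y) (hx : x ∈ ψ.source) (hρ : ‖ψ x‖ + c * |t| ≤ ρ)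
    (hρR : ρ < R) {z : E} (hz : dist z (ψ y) * Real.exp (c * |t|) ≤ (R - ρ) / 2) :
    ∃ z', dist z' (ψ x) ≤ dist z (ψ y) * Real.exp (c * |t|) ∧
      Relation.ReflTransGen (FlowStep S) (ψ.symm z) (ψ.symm z') := by
  obtain ⟨δ, v, hv, rfl, rfl, -, hδ⟩ := hxy.exists_curve 0
  rw [zero_add] at hδ hz ⊢
  have hmem := h.mem_source_of_curve hv hδ hx (by simpa using hρ.trans hρR.le)
  have hsol : IsSolutionIn (fun z => chartVelocity ψ v (ψ.symm z)) (Metric.closedBall 0 ρ)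
      (ψ ∘ δ) (Icc 0 |t|) := by
    intro u hu
    obtain ⟨h1, h2⟩ := hmem u hu
    constructor
    · rw [mem_closedBall_zero_iff]
      have h3 : ‖ψ (δ u)‖ ≤ ‖ψ (δ u) - ψ (δ 0)‖ + ‖ψ (δ 0)‖ := by
        simpa using norm_add_le (ψ (δ u) - ψ (δ 0)) (ψ (δ 0))
      rw [dist_eq_norm, sub_zero] at h2
      exact h3.trans (by linarith)
    · have := hasDerivWithinAt_chart_comp h.mdifferentiable hδ hu h1
      simpa only [Function.comp_apply, ψ.left_inv h1] using this
  -- Reversing time gives a trajectory of the opposite field from `ψ y` to `ψ x`, to which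
  -- `exists_trajectory_near` applies.
  have hneg := hv.neg
  have hrev := hsol.reverse
  simp only [← chartVelocity_neg, zero_add] at hrev
  obtain ⟨z', h1, h2⟩ := exists_trajectory_near (z := z) hρR (abs_nonneg t)
    (fun w hw => h.norm_chartVelocity_le hneg (ψ.map_target (h.closedBall_subset hw)))
    (h.lipschitzOnWith hneg) hrev (by simpa using hz)
  refine ⟨z', by simpa using h1, ?_⟩
  exact Relation.ReflTransGen.lift ψ.symm
    (fun a b hab => h.flowStep_of_trajectoryStep hX hneg hab) _ _ h2

/-! ### Infinite compositions of flows -/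

/-- An infinite sequence of flow trajectories, controlled in a chart, from `x` to `y`. -/
structure IsL1Trajectory (ψ : OpenPartialHomeomorph M E) (R ρ : ℝ) (c : NNReal)
    (ξ : ℕ → LocalVectorField E M) (τ : ℕ → ℝ) (p : ℕ → M) (x y : M) : Prop where
  lt : ρ < R
  controlled : ∀ n, IsControlled ψ R c (ξ n)
  summable : Summable fun n => |τ n|
  mem_source : x ∈ ψ.source
  norm_add_tsum_le : ‖ψ x‖ + c * ∑' n, |τ n| ≤ ρ
  zero : p 0 = x
  flow : ∀ n, FlowRel (ξ n) (τ n) (p n) (p (n + 1))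
  tendsto : Tendsto p atTop (𝓝 y)

lemma IsL1FlowMap.exists_isL1Trajectory {s : ℕ} {ξ : ℕ → LocalVectorField E M} {τ : ℕ → ℝ}
    {e : OpenPartialHomeomorph M M} (h : IsL1FlowMap s ξ τ e) (hx : x ∈ e.source) :
    ∃ ψ R ρ c p, IsL1Trajectory ψ R ρ c ξ τ p x (e x) := by
  obtain ⟨x₀, ψ, r, c, hψ, hr, hc, hball, hdom, hjet, hτ, hτle, -, -, hsub, -, hp⟩ := h
  obtain ⟨p, hp0, hpf, hpt⟩ := hp x hx
  obtain ⟨hxψ, hxr⟩ := hsub hx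
  have hxr' : ‖ψ x‖ < r := by simpa using hxr
  have hcle : c * ∑' n, |τ n| ≤ r := by
    rw [le_div_iff₀ hc] at hτle
    linarith
  -- Displacements total at most `c‖τ‖₁ ≤ r`, so radius `ρ = ‖ψ x‖ + r` suffices, and `ρ < 2 * r`
  -- because `‖ψ x‖ < r`.
  refine ⟨ψ, 2 * r, ‖ψ x‖ + r, ⟨c, hc.le⟩, p, by linarith, fun n => ⟨hψ.1, hball, hdom n,
    fun y hy => ?_, ?_⟩, hτ, hxψ, ?_, hp0, hpf, hpt⟩
  · rw [← localRep_apply hy]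
    exact norm_localRep_le.trans (hjet n y hy)
  · exact lipschitzOnWith_localRep hψ.1 (hdom n) (m := s + 2) (c := ⟨c, hc.le⟩) (by omega) (hjet n)
      (convex_closedBall 0 _) hball
  · change ‖ψ x‖ + c * ∑' n, |τ n| ≤ ‖ψ x‖ + r
    linarith

namespace IsL1Trajectory

variable {ξ : ℕ → LocalVectorField E M} {τ : ℕ → ℝ} {p : ℕ → M}

lemma norm_add_sum_le (h : IsL1Trajectory ψ R ρ c ξ τ p x y) (n : ℕ) :
    ‖ψ x‖ + c * ∑ i ∈ Finset.range n, |τ i| ≤ ρ := by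
  refine le_trans ?_ h.norm_add_tsum_le
  gcongr
  exact h.summable.sum_le_tsum _ fun i _ => abs_nonneg _

variable [T2Space M] [CompleteSpace E]

/-- Each flow of time `τ i` moves the chart coordinate by at most `c|τ i|`, so the sequence never
gets near radius `R`. -/
lemma point_mem_source (h : IsL1Trajectory ψ R ρ c ξ τ p x y) (n : ℕ) :
    p n ∈ ψ.source ∧ ‖ψ (p n)‖ ≤ ‖ψ x‖ + c * ∑ i ∈ Finset.range n, |τ i| := by
  induction n with
  | zero => simp [h.zero, h.mem_source]
  | succ n ih =>
    have h1 := h.norm_add_sum_le (n + 1)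
    rw [Finset.sum_range_succ, mul_add] at h1 ⊢
    obtain ⟨h2, h3⟩ := (h.controlled n).flowRel_mem_source (h.flow n) ih.1
      (by linarith [h.lt, ih.2])
    refine ⟨h2, ?_⟩
    have h4 : ‖ψ (p (n + 1))‖ ≤ ‖ψ (p (n + 1)) - ψ (p n)‖ + ‖ψ (p n)‖ := by
      simpa using norm_add_le (ψ (p (n + 1)) - ψ (p n)) (ψ (p n))
    rw [dist_eq_norm] at h3
    linarith [ih.2]

lemma norm_point_add_le (h : IsL1Trajectory ψ R ρ c ξ τ p x y) (n : ℕ) :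
    ‖ψ (p n)‖ + c * |τ n| ≤ ρ := by
  have h1 := h.norm_add_sum_le (n + 1)
  rw [Finset.sum_range_succ, mul_add] at h1
  linarith [(h.point_mem_source n).2]

/-- Convergence of `p` in `M` alone does not put the limit in the chart. The coordinates are Cauchy
with limit in the closed ball, and limits in `M` are unique. -/
lemma end_mem_source (h : IsL1Trajectory ψ R ρ c ξ τ p x y) : y ∈ ψ.source := by
  have hd : ∀ n, dist (ψ (p n)) (ψ (p (n + 1))) ≤ c * |τ n| := fun n => by
    rw [dist_comm]
    exact ((h.controlled n).flowRel_mem_source (h.flow n) (h.point_mem_source n).1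
      ((h.norm_point_add_le n).trans h.lt.le)).2
  obtain ⟨z, hz⟩ := cauchySeq_tendsto_of_complete
    (cauchySeq_of_dist_le_of_summable _ hd (h.summable.mul_left _))
  have hzt : z ∈ ψ.target := by
    refine (h.controlled 0).closedBall_subset (Metric.isClosed_closedBall.mem_of_tendsto hz
      (Eventually.of_forall fun n => ?_))
    have h1 : 0 ≤ c * |τ n| := by positivity
    rw [mem_closedBall_zero_iff]
    linarith [h.norm_point_add_le n, h.lt]
  have h1 : Tendsto p atTop (𝓝 (ψ.symm z)) :=
    ((ψ.continuousAt_symm hzt).tendsto.comp hz).congr fun n => ψ.left_inv (h.point_mem_source n).1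
  rw [tendsto_nhds_unique h.tendsto h1]
  exact ψ.map_target hzt

lemma tendsto_chart (h : IsL1Trajectory ψ R ρ c ξ τ p x y) :
    Tendsto (fun n => ψ (p n)) atTop (𝓝 (ψ y)) :=
  (ψ.continuousAt h.end_mem_source).tendsto.comp h.tendsto

lemma l1Step (h : IsL1Trajectory ψ R ρ c ξ τ p x y) (hξ : ∀ n, ξ n ∈ S) : L1Step S x y := by
  intro b
  set t : ℕ → ℝ := fun n => b + ∑ i ∈ Finset.range n, |τ i| with ht
  have htsucc : ∀ n, t (n + 1) = t n + |τ n| := fun n => by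
    simp only [ht, Finset.sum_range_succ, add_assoc]
  have htmono : Monotone t := monotone_nat_of_le_succ fun n => by
    rw [htsucc]
    exact le_add_of_nonneg_right (abs_nonneg _)
  have ht0 : t 0 = b := by simp [ht]
  have htlim : Tendsto t atTop (𝓝 (b + ∑' n, |τ n|)) :=
    h.summable.hasSum.tendsto_sum_nat.const_add b
  choose δ v hv h0 h1 hdom hδ using fun n => (h.flow n).exists_curve (t n)
  simp only [← htsucc] at h1 hdom hδ
  -- Piece `n` stays within `c|τ n|` of `ψ (p n)`, and both `c|τ n| → 0` and `ψ (p n) → ψ y`.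
  have hlim : ∀ U ∈ 𝓝 y, ∀ᶠ n in atTop, ∀ u ∈ Icc (t n) (t (n + 1)), δ n u ∈ U := by
    intro U hU
    have hy := h.end_mem_source
    have h2 : ψ.symm ⁻¹' U ∈ 𝓝 (ψ y) := by
      refine (ψ.continuousAt_symm (ψ.map_source hy)).preimage_mem_nhds ?_
      rwa [ψ.left_inv hy]
    obtain ⟨ε, hε, hεU⟩ := Metric.mem_nhds_iff.1 h2
    have h3 : Tendsto (fun n => dist (ψ (p n)) (ψ y) + c * |τ n|) atTop (𝓝 0) := by
      simpa using (tendsto_iff_dist_tendsto_zero.1 h.tendsto_chart).add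
        (h.summable.tendsto_atTop_zero.const_mul (c : ℝ))
    filter_upwards [h3.eventually_lt_const hε] with n hn u hu
    obtain ⟨h4, h5⟩ := (h.controlled n).mem_source_of_curve (hv n) (hδ n)
      (by rw [h0]; exact (h.point_mem_source n).1)
      (by
        rw [h0, htsucc, add_sub_cancel_left]
        exact (h.norm_point_add_le n).trans h.lt.le) u hu
    rw [h0, htsucc, add_sub_cancel_left] at h5
    have h6 : ψ (δ n u) ∈ Metric.ball (ψ y) ε := by
      rw [Metric.mem_ball]
      linarith [dist_triangle (ψ (δ n u)) (ψ (p n)) (ψ y)]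
    have h7 := hεU h6
    rwa [mem_preimage, ψ.left_inv h4] at h7
  obtain ⟨γ, hγc, hγ0, hγb, hγ⟩ := exists_continuousOn_of_pieces htmono htlim h.tendsto h0 h1
    (fun n => isMIntegralCurveOn_continuousOn (hδ n)) hlim
  rw [ht0] at hγc hγ0
  refine ⟨γ, b + ∑' n, |τ n|, le_add_of_nonneg_right (tsum_nonneg fun n => abs_nonneg _),
    hγ0.trans h.zero, hγb, hγc, t, htmono, ht0, htlim, fun n _ => ?_⟩
  have h2 : IsTangentPiece S (δ n) (Icc (t n) (t (n + 1))) :=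
    isTangentPiece_iff.2 ⟨ξ n, hξ n, v n, hv n, hdom n, hδ n⟩
  exact (h2.congr (hγ n)).mono Ioo_subset_Icc_self

lemma exists_flow_back (h : IsL1Trajectory ψ R ρ c ξ τ p x y) (hξ : ∀ n, ξ n ∈ S) (n : ℕ) {z : E}
    (hz : dist z (ψ (p n)) * Real.exp (c * ∑ i ∈ Finset.range n, |τ i|) ≤ (R - ρ) / 2) :
    ∃ z', dist z' (ψ x) ≤ dist z (ψ (p n)) * Real.exp (c * ∑ i ∈ Finset.range n, |τ i|) ∧
      Relation.ReflTransGen (FlowStep S) (ψ.symm z) (ψ.symm z') := by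
  induction n generalizing z with
  | zero => exact ⟨z, by simp [h.zero], Relation.ReflTransGen.refl⟩
  | succ n ih =>
    have hexp : Real.exp (c * ∑ i ∈ Finset.range (n + 1), |τ i|) =
        Real.exp (c * |τ n|) * Real.exp (c * ∑ i ∈ Finset.range n, |τ i|) := by
      rw [← Real.exp_add, Finset.sum_range_succ]
      ring_nf
    rw [hexp, ← mul_assoc] at hz ⊢
    -- As the remaining Grönwall factors are at least `1`, the bound on the full product also
    -- supplies the margin for this single step.
    have h1 : 1 ≤ Real.exp (c * ∑ i ∈ Finset.range n, |τ i|) :=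
      Real.one_le_exp (mul_nonneg c.2 (Finset.sum_nonneg fun i _ => abs_nonneg _))
    obtain ⟨w, h2, h3⟩ := (h.controlled n).exists_flow_back (hξ n) (h.flow n)
      (h.point_mem_source n).1 (h.norm_point_add_le n) h.lt (z := z)
      ((le_mul_of_one_le_right (by positivity) h1).trans hz)
    have h4 : dist w (ψ (p n)) * Real.exp (c * ∑ i ∈ Finset.range n, |τ i|) ≤
        dist z (ψ (p (n + 1))) * Real.exp (c * |τ n|) *
          Real.exp (c * ∑ i ∈ Finset.range n, |τ i|) := by
      gcongr
    obtain ⟨z', h5, h6⟩ := ih (h4.trans hz)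
    exact ⟨z', h5.trans h4, h3.trans h6⟩

/-- The origin of the trajectory is a limit of points that are reached from its end. -/
lemma mem_closure_reach (h : IsL1Trajectory ψ R ρ c ξ τ p x y) (hξ : ∀ n, ξ n ∈ S) :
    x ∈ closure {w | Relation.ReflTransGen (FlowStep S) y w} := by
  -- `C` dominates the Grönwall factors for all `n` at once; thus a large `n` makes the backward
  -- error from `y` as small as desired.
  set C : ℝ := Real.exp (c * ∑' n, |τ n|) with hC
  have hlim : Tendsto (fun n => dist (ψ y) (ψ (p n)) * C) atTop (𝓝 0) := by
    have := (tendsto_iff_dist_tendsto_zero.1 h.tendsto_chart).mul_const C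
    simpa [dist_comm] using this
  rw [mem_closure_iff_nhds]
  intro U hU
  have h2 : ψ.symm ⁻¹' U ∈ 𝓝 (ψ x) := by
    refine (ψ.continuousAt_symm (ψ.map_source h.mem_source)).preimage_mem_nhds ?_
    rwa [ψ.left_inv h.mem_source]
  obtain ⟨ε, hε, hεU⟩ := Metric.mem_nhds_iff.1 h2
  have hη : 0 < (R - ρ) / 2 := by linarith [h.lt]
  obtain ⟨n, hn⟩ := (hlim.eventually_lt_const (lt_min hε hη)).exists
  have hle : dist (ψ y) (ψ (p n)) * Real.exp (c * ∑ i ∈ Finset.range n, |τ i|) ≤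
      dist (ψ y) (ψ (p n)) * C := by
    rw [hC]
    gcongr
    exact h.summable.sum_le_tsum _ fun i _ => abs_nonneg _
  obtain ⟨z', h3, h4⟩ := h.exists_flow_back hξ n
    (hle.trans (hn.le.trans (min_le_right _ _)))
  rw [ψ.left_inv h.end_mem_source] at h4
  refine ⟨ψ.symm z', hεU ?_, h4⟩
  exact (h3.trans hle).trans_lt (hn.trans_le (min_le_left _ _))

end IsL1Trajectory

/-! ### Reachable points and orbits -/

lemma reflTransGen_flowStep_symm (h : Relation.ReflTransGen (FlowStep S) x y) :
    Relation.ReflTransGen (FlowStep S) y x := by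
  induction h with
  | refl => exact Relation.ReflTransGen.refl
  | tail _ h ih => exact ih.head h.symm

lemma reflTransGen_of_comp {l : List (OpenPartialHomeomorph M M)} (hl : ∀ e ∈ l, IsFlowMapOf S e)
    (hx : x ∈ (comp l).source) : Relation.ReflTransGen (FlowStep S) x (comp l x) := by
  induction l generalizing x with
  | nil => exact Relation.ReflTransGen.refl
  | cons e l ih =>
    change x ∈ (e.trans (comp l)).source at hx
    rw [OpenPartialHomeomorph.trans_source] at hx
    obtain ⟨Z, hZ, t, he⟩ := hl e (by simp)
    exact Relation.ReflTransGen.head ⟨Z, hZ, t, he.2 x hx.1⟩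
      (ih (fun f hf => hl f (by simp [hf])) hx.2)

variable {φ : M → OpenPartialHomeomorph M E} {k : M → ℝ} {m s : ℕ}

/-- Go back along `Φ⁻¹`, follow `X` for time `ν * t`, return along `Φ`. Working with points avoids
the need for a flow map of `Y` on an open set. -/
lemma FlowStep.of_hat (h : FlowStep (hat φ k m S) x y) :
    Relation.ReflTransGen (FlowStep S) x y := by
  obtain ⟨Y, ⟨⟨l, ν, X, hX, hl, hν, hY⟩, -⟩, t, hxy⟩ := h
  have hl' : ∀ e ∈ l, IsFlowMapOf S e := hl
  have hm := (IsLocalDiffeo.comp fun f hf => (hl' f hf).isLocalDiffeo).mdifferentiable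
  have h1 : ∀ w ∈ Y.dom, Relation.ReflTransGen (FlowStep S) ((comp l).symm w) w := fun w hw => by
    have hw' := (hY.pullback hm hw).1
    have := reflTransGen_of_comp hl' ((comp l).map_target hw')
    rwa [(comp l).right_inv hw'] at this
  have h2 : FlowStep S ((comp l).symm x) ((comp l).symm y) :=
    ⟨X, hX, ν * t, hxy.pullback hY hν hm⟩
  exact ((reflTransGen_flowStep_symm (h1 x hxy.mem_dom.1)).tail h2).trans (h1 y hxy.mem_dom.2)

lemma reflTransGen_of_hat (h : Relation.ReflTransGen (FlowStep (hat φ k m S)) x y) :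
    Relation.ReflTransGen (FlowStep S) x y := by
  induction h with
  | refl => exact Relation.ReflTransGen.refl
  | tail _ h ih => exact ih.trans h.of_hat

variable [T2Space M] [CompleteSpace E]

lemma IsGenerator.mem_closure {e : OpenPartialHomeomorph M M} (he : IsGenerator φ k s S e)
    (hx : x ∈ e.source) : e x ∈ closure {w | Relation.ReflTransGen (FlowStep S) x w} := by
  rcases he with ⟨X, hX, t, he⟩ | ⟨ξ, τ, hξ, he | he⟩
  · exact subset_closure (Relation.ReflTransGen.single ⟨X, hX, t, he.2 x hx⟩)
  · obtain ⟨ψ, R, ρ, c, p, h⟩ := he.exists_isL1Trajectory hx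
    refine mem_closure_of_tendsto h.tendsto (Eventually.of_forall fun n => ?_)
    have : Relation.ReflTransGen (FlowStep S) (p 0) (p n) := by
      induction n with
      | zero => exact Relation.ReflTransGen.refl
      | succ n ih => exact ih.trans (FlowStep.of_hat ⟨ξ n, hξ n, τ n, h.flow n⟩)
    rwa [h.zero] at this
  -- Here `e x` is the origin and `x` the end of the infinite trajectory.
  · obtain ⟨ψ, R, ρ, c, p, h⟩ := he.exists_isL1Trajectory (e.map_source hx)
    rw [e.left_inv hx] at h
    exact closure_mono (fun w hw => reflTransGen_of_hat hw) (h.mem_closure_reach hξ)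

/-- Approximate `z` by reachable `w` in the source of the generator `e`: then `e w` is near `e z` by
continuity, and lies in the closure of what `w`, hence `x`, reaches. -/
lemma comp_mem_closure {l : List (OpenPartialHomeomorph M M)}
    (hl : ∀ e ∈ l, IsGenerator φ k s S e) {z : M}
    (hz : z ∈ closure {w | Relation.ReflTransGen (FlowStep S) x w})
    (hzl : z ∈ (comp l).source) :
    comp l z ∈ closure {w | Relation.ReflTransGen (FlowStep S) x w} := by
  induction l generalizing z with
  | nil => exact hz
  | cons e l ih =>
    change z ∈ (e.trans (comp l)).source at hzl
    rw [OpenPartialHomeomorph.trans_source] at hzl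
    refine ih (fun f hf => hl f (by simp [hf])) ?_ hzl.2
    rw [← closure_closure, mem_closure_iff_nhds]
    intro U hU
    have h1 : e ⁻¹' U ∩ e.source ∈ 𝓝 z := inter_mem
      ((e.continuousAt hzl.1).preimage_mem_nhds hU) (e.open_source.mem_nhds hzl.1)
    obtain ⟨w, ⟨hwU, hws⟩, hxw⟩ := mem_closure_iff_nhds.1 hz _ h1
    exact ⟨e w, hwU, closure_mono (fun q hq => Relation.ReflTransGen.trans hxw hq)
      ((hl e (by simp)).mem_closure hws)⟩

lemma orbit_subset_closure (hy : y ∈ orbit φ k s S x) :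
    y ∈ closure {w | Relation.ReflTransGen (FlowStep S) x w} := by
  obtain ⟨Ψ, ⟨l, -, hl, h1, h2⟩, hx, rfl⟩ := hy
  rw [h2 hx]
  exact comp_mem_closure hl (subset_closure Relation.ReflTransGen.refl) (h1 hx)

lemma IsGenerator.l1Step (hbound : ∀ x, ∀ X ∈ S, x ∈ X.dom → jetNorm (φ x) (s + 2) X x ≤ k x)
    {e : OpenPartialHomeomorph M M} (he : IsGenerator φ k s S e) (hx : x ∈ e.source) :
    L1Step (hat φ k (s + 2) S) x (e x) ∨ L1Step (hat φ k (s + 2) S) (e x) x := by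
  rcases he with ⟨X, hX, t, he⟩ | ⟨ξ, τ, hξ, he | he⟩
  · left
    intro b
    have hXhat := mem_hat_of_mem hbound hX (he.2 x hx).mem_dom.1
    obtain ⟨δ, v, hv, h1, h2, h3, h4⟩ := (he.2 x hx).exists_curve b
    have hb : b ≤ b + |t| := by linarith [abs_nonneg t]
    refine ⟨δ, b + |t|, hb, h1, h2, isMIntegralCurveOn_continuousOn h4,
      -- A single trajectory is an `l¹`-integral curve with subdivision `b, b + |t|, b + |t|, …`.
      fun n => if n = 0 then b else b + |t|, ?_, by simp, ?_, fun n hn => ?_⟩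
    · refine monotone_nat_of_le_succ fun n => ?_
      by_cases hn : n = 0 <;> simp [hn]
    · exact tendsto_const_nhds.congr' (eventually_atTop.2 ⟨1, fun n hn =>
        (if_neg (by omega)).symm⟩)
    · have hp : IsTangentPiece (hat φ k (s + 2) S) δ (Icc b (b + |t|)) :=
        isTangentPiece_iff.2 ⟨X, hXhat, v, hv, h3, h4⟩
      refine hp.mono fun u hu => ?_
      by_cases h0 : n = 0
      · simp only [h0, if_true, zero_add, one_ne_zero, if_false] at hu
        exact ⟨hu.1.le, hu.2.le⟩
      · simp [h0] at hn
  · obtain ⟨ψ, R, ρ, c, p, h⟩ := he.exists_isL1Trajectory hx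
    exact Or.inl (h.l1Step hξ)
  · obtain ⟨ψ, R, ρ, c, p, h⟩ := he.exists_isL1Trajectory (e.map_source hx)
    rw [e.left_inv hx] at h
    exact Or.inr (h.l1Step hξ)

lemma reflTransGen_l1Step_of_comp
    (hbound : ∀ x, ∀ X ∈ S, x ∈ X.dom → jetNorm (φ x) (s + 2) X x ≤ k x)
    {l : List (OpenPartialHomeomorph M M)} (hl : ∀ e ∈ l, IsGenerator φ k s S e)
    (hx : x ∈ (comp l).source) :
    Relation.ReflTransGen (fun x y => L1Step (hat φ k (s + 2) S) x y ∨
      L1Step (hat φ k (s + 2) S) y x) x (comp l x) := by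
  induction l generalizing x with
  | nil => exact Relation.ReflTransGen.refl
  | cons e l ih =>
    change x ∈ (e.trans (comp l)).source at hx
    rw [OpenPartialHomeomorph.trans_source] at hx
    exact Relation.ReflTransGen.head ((hl e (by simp)).l1Step hbound hx.1)
      (ih (fun f hf => hl f (by simp [hf])) hx.2)

end

/-- A chart transports the countable neighborhood bases of `E` to `M`, so closure points are limits
of sequences. -/
lemma exists_seq_tendsto_of_mem_closure (E : Type*) {M : Type*} [NormedAddCommGroup E]
    [TopologicalSpace M] [ChartedSpace E M] {A : Set M} {y : M} (hy : y ∈ closure A) :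
    ∃ q : ℕ → M, (∀ n, q n ∈ A) ∧ Tendsto q atTop (𝓝 y) := by
  have : (𝓝 y).IsCountablyGenerated := by
    have h := mem_chart_source E y
    rw [← (chartAt E y).symm_map_nhds_eq h]
    infer_instance
  obtain ⟨q, hq, hqA⟩ := exists_seq_forall_of_frequently (mem_closure_iff_frequently.1 hy)
  exact ⟨q, hqA, hq⟩

end L1Orbit

theorem mainTheorem10 {E M : Type*} [NormedAddCommGroup E] [NormedSpace ℝ E] [CompleteSpace E]
    [TopologicalSpace M] [T2Space M] [ConnectedSpace M] [ChartedSpace E M]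
    [IsManifold 𝓘(ℝ, E) ∞ M]
    (S : Set (L1Orbit.LocalVectorField E M)) (s : ℕ)
    (φ : M → OpenPartialHomeomorph M E) (k : M → ℝ)
    (hφ : ∀ x, L1Orbit.IsChartCenteredAt (φ x) x)
    (hcover : ∀ x, ∃ X ∈ S, x ∈ X.dom)
    (hbound : ∀ x, ∀ X ∈ S, x ∈ X.dom → L1Orbit.jetNorm (φ x) (s + 2) X x ≤ k x) :
    (∀ x, ∀ y ∈ L1Orbit.orbit φ k s S x, ∃ (γ : ℝ → M) (a b : ℝ), a ≤ b ∧
      L1Orbit.IsL1Curve (L1Orbit.hat φ k (s + 2) S) γ a b ∧ γ a = x ∧ γ b = y) ∧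
    (∀ x, ∀ y ∈ L1Orbit.orbit φ k s S x,
      (∃ (γ : ℝ → M) (a b : ℝ), a ≤ b ∧
        L1Orbit.IsPiecewiseSmoothCurve S γ a b ∧ γ a = x ∧ γ b = y) ∨
      (∃ (γ : ℕ → ℝ → M) (a b : ℕ → ℝ), (∀ n, a n ≤ b n ∧
        L1Orbit.IsPiecewiseSmoothCurve S (γ n) (a n) (b n) ∧ γ n (a n) = x) ∧
        Tendsto (fun n => γ n (b n)) atTop (𝓝 y))) ∧
    L1Orbit.pseudogroup φ k s (L1Orbit.hat φ k (s + 2) S) = L1Orbit.pseudogroup φ k s S ∧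
    (∀ x, L1Orbit.orbit φ k s (L1Orbit.hat φ k (s + 2) S) x = L1Orbit.orbit φ k s S x) := by
  -- The approximating alternative always holds: if `y` itself is reachable, a constant sequence of
  -- curves serves.
  refine ⟨fun x y hy => ?_, fun x y hy => Or.inr ?_, L1Orbit.pseudogroup_hat hcover hbound,
    fun x => ?_⟩
  · obtain ⟨Ψ, ⟨l, -, hl, h1, h2⟩, hx, rfl⟩ := hy
    rw [h2 hx]
    exact L1Orbit.exists_isL1Curve (L1Orbit.reflTransGen_l1Step_of_comp hbound hl (h1 hx))
  · obtain ⟨q, hq, hqy⟩ :=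
      L1Orbit.exists_seq_tendsto_of_mem_closure E (L1Orbit.orbit_subset_closure hy)
    choose γ a b hab hγ ha hb using fun n => L1Orbit.exists_isPiecewiseSmoothCurve (hq n)
    exact ⟨γ, a, b, fun n => ⟨hab n, hγ n, ha n⟩, by simpa only [hb] using hqy⟩
  · unfold L1Orbit.orbit
    rw [L1Orbit.pseudogroup_hat hcover hbound]
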